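/- A betweenness structure is a pair $\mathcal B=(X,\beta)$ of a nonempty finite set $X$ and a relation $\beta\subseteq X^3$; write $(x\ y\ z)$ for $(x,y,z)\in\beta$. Its order is $|X|$. It is almost-metrizable if for all $x,y,z,w\in X$: (P1) $(x\ x\ z)$; (P2) $(x\ y\ z)\Rightarrow(z\ y\ x)$; (P3) $(x\ y\ z)\wedge(y\ x\ z)\Rightarrow x=y$; (P4) $(x\ y\ z)\wedge(x\ w\ y)\Rightarrow(x\ w\ z)\wedge(w\ y\ z)$. A triangle is a set of three distinct points none of whose orderings belongs to $\beta$; the co-size is the number of triangles. Let $\tau(n,0)$ be the minimum positive co-size of an almost-metrizable betweenness structure of order $n$, when there is one. An almost-metrizable betweenness structure of order $n$ is quasilinear if its co-size is $\tau(n,0)$ (so it has a triangle). A connected graph $G$ with positive edge weights induces the betweenness structure $\mathcal B(G)$ on its vertex set in which $(x\ y\ z)$ holds iff $d(x,z)=d(x,y)+d(y,z)$ for the shortest-path metric $d$ of $G$; edges have weight $1$ unless stated otherwise. For $n\ge5$ consider the path $x_1x_2\cdots x_{n-2}$ and two further vertices $y,z$. For $1\le i\le\lceil (n-3)/2\rceil$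 let $R^4_{n,i}$ arise by deleting the edge $\{x_i,x_{i+1}\}$ and adding the edges $\{y,x_i\},\{z,x_i\},\{y,x_{i+1}\},\{z,x_{i+1}\}$. Let $S^4_n$ arise by adding the edges $\{x_1,y\}$, $\{x_{n-2},z\}$ and the edge $\{y,z\}$ of weight $n-3$. **Theorem.** 1. For every $n\ge3$, $\tau(n,0)$ is defined and $\tau(n,0)=\max\{1,n-4\}$. 2. A betweenness structure is quasilinear if and only if it is isomorphic to one of: $\mathcal B(R^4_{n,i})$ with $n\ge5$ and $1\le i\le\lceil (n-3)/2\rceil$; $\mathcal B(S^4_n)$ with $n\ge5$; or $\mathcal B(G)$, where $G$ is one of the following eight graphs: $K_3$; $K_{1,3}$; the cycle $C_4$ in which two adjacent edges have weight $2$ and the other two have weight $1$; $K_{2,3}$; $C_6$; $C_6$ with one long diagonal; $C_6$ with two long diagonals; $K_{3,3}$ (a long diagonal joins two opposite vertices of the cycle $C_6$). -/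

import Mathlib

/-- A ternary relation on a point set `X`; `B.rel x y z` says that `y` is between `x` and `z`.
(Finiteness and non-emptiness of `X` are assumed where structures are quantified over.) -/
structure BetweennessStructure (X : Type*) where
  rel : X → X → X → Prop

namespace BetweennessStructure

/-- The four elementary properties of metric betweenness; `p4` is the four relations property. -/
structure AlmostMetrizable {X : Type*} (B : BetweennessStructure X) : Prop where
  p1 : ∀ x z, B.rel x x z
  p2 : ∀ x y z, B.rel x y z → B.rel z y x
  p3 : ∀ x y z, B.rel x y z → B.rel y x z → x = y
  p4 : ∀ x y z w, B.rel x y z → B.rel x w y → B.rel x w z ∧ B.rel w y z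

/-- A triangle: a set of three points none of whose orderings is in the betweenness relation. -/
def IsTriangle {X : Type*} (B : BetweennessStructure X) (T : Finset X) : Prop :=
  T.card = 3 ∧ ∀ x ∈ T, ∀ y ∈ T, ∀ z ∈ T, x ≠ y → y ≠ z → x ≠ z → ¬ B.rel x y z

/-- The co-size: the number of triangles. -/
noncomputable def coSize {X : Type*} (B : BetweennessStructure X) : ℕ :=
  {T : Finset X | B.IsTriangle T}.ncard

/-- Isomorphism of betweenness structures. -/
def Iso {X Y : Type*} (B : BetweennessStructure X) (C : BetweennessStructure Y) : Prop :=
  ∃ e : X ≃ Y, ∀ x y z, B.rel x y z ↔ C.rel (e x) (e y) (e z)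

/-- The almost-metrizable betweenness structures of order `n` and co-size `m`
(on the ground set `Fin n`, which represents every isomorphism type). -/
def ofOrderCoSize (n m : ℕ) : Set (BetweennessStructure (Fin n)) :=
  {B | B.AlmostMetrizable ∧ B.coSize = m}

/-- `IsTau n k t` says that `t` is the minimum of the `m > k` for which there is an
almost-metrizable betweenness structure of order `n` and co-size `m`, i.e. `τ(n, k)` is defined
and equals `t`. -/
def IsTau (n k t : ℕ) : Prop :=
  IsLeast {m : ℕ | k < m ∧ (ofOrderCoSize n m).Nonempty} t

/-- Quasilinear: almost-metrizable, of co-size `τ(n, 0)`, where `n` is the order. -/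
def Quasilinear {X : Type*} (B : BetweennessStructure X) : Prop :=
  B.AlmostMetrizable ∧ IsTau (Nat.card X) 0 B.coSize

end BetweennessStructure

/-- A simple graph with a positive real weight on every edge
(values of `weight` on non-adjacent pairs are irrelevant). -/
structure WeightedGraph (V : Type*) where
  graph : SimpleGraph V
  weight : V → V → ℝ
  weight_symm : ∀ u v, weight u v = weight v u
  weight_pos : ∀ u v, graph.Adj u v → 0 < weight u v

namespace WeightedGraph

/-- A simple graph, regarded as a weighted graph with all weights `1`. -/
def ofSimple {V : Type*} (G : SimpleGraph V) : WeightedGraph V where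
  graph := G
  weight _ _ := 1
  weight_symm _ _ := rfl
  weight_pos _ _ _ := one_pos

/-- The length of a walk: the sum of the weights of its edges. -/
def walkLength {V : Type*} (W : WeightedGraph V) {u v : V} (p : W.graph.Walk u v) : ℝ :=
  (p.darts.map fun d => W.weight d.fst d.snd).sum

/-- The graph metric of a connected weighted graph: the length of a shortest walk
(equivalently, as weights are positive, of a shortest path). -/
noncomputable def dist {V : Type*} (W : WeightedGraph V) (u v : V) : ℝ :=
  ⨅ p : W.graph.Walk u v, W.walkLength p

/-- The betweenness structure induced by the graph metric. -/
def betweenness {V : Type*} (W : WeightedGraph V) : BetweennessStructure V where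
  rel x y z := W.dist x z = W.dist x y + W.dist y z

/-- The vertices `x₁, …, x_m, y, z`; `x j` with `j : Fin m` stands for `x_{j+1}`. -/
inductive Vertex (m : ℕ) : Type
  | x (j : Fin m)
  | y
  | z

/-- The edges of `R⁴_{n,i}`, each in one direction: the path `x₁ x₂ … x_{n-2}` without the edge
`{x_i, x_{i+1}}`, and `y`, `z` both joined to `x_i` and `x_{i+1}`. -/
def r4Rel (n i : ℕ) : Vertex (n - 2) → Vertex (n - 2) → Prop
  | .x j, .x k => k.val = j.val + 1 ∧ j.val + 1 ≠ i
  | .y, .x j => j.val + 1 = i ∨ j.val + 1 = i + 1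
  | .z, .x j => j.val + 1 = i ∨ j.val + 1 = i + 1
  | _, _ => False

/-- The graph `R⁴_{n,i}` (for `n ≥ 5` and `i ∈ I⁴_n`). -/
def r4 (n i : ℕ) : WeightedGraph (Vertex (n - 2)) :=
  ofSimple (SimpleGraph.fromRel (r4Rel n i))

/-- The index set `I⁴_n = {i : 1 ≤ i ≤ ⌈(n - 3) / 2⌉}`. -/
def i4 (n : ℕ) : Set ℕ :=
  {i | 1 ≤ i ∧ (i : ℤ) ≤ ⌈((n : ℚ) - 3) / 2⌉}

/-- The edges of `S⁴_n`, each in one direction: the path `x₁ x₂ … x_{n-2}` and the edges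
`{x₁, y}`, `{x_{n-2}, z}`, `{y, z}`. -/
def s4Rel (n : ℕ) : Vertex (n - 2) → Vertex (n - 2) → Prop
  | .x j, .x k => k.val = j.val + 1
  | .x j, .y => j.val + 1 = 1
  | .x j, .z => j.val + 1 = n - 2
  | .y, .z => True
  | _, _ => False

/-- The weights of `S⁴_n`: `n - 3` on `{y, z}`, and `1` otherwise. -/
def s4Weight (n : ℕ) : Vertex (n - 2) → Vertex (n - 2) → ℝ
  | .y, .z => (n : ℝ) - 3
  | .z, .y => (n : ℝ) - 3
  | _, _ => 1

/-- The graph `S⁴_n` for `n ≥ 5`. -/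
def s4 (n : ℕ) (hn : 5 ≤ n) : WeightedGraph (Vertex (n - 2)) where
  graph := SimpleGraph.fromRel (s4Rel n)
  weight := s4Weight n
  weight_symm u v := by cases u <;> cases v <;> rfl
  weight_pos u v _ := by
    have h : (5 : ℝ) ≤ n := by exact_mod_cast hn
    cases u <;> cases v <;> simp only [s4Weight] <;> linarith

/-- The cycle `C₄` in which the two edges at the vertex `3` have weight `2` and the other two
have weight `1`. -/
noncomputable def weightedC4 : WeightedGraph (Fin 4) where
  graph := SimpleGraph.cycleGraph 4
  weight u v := if u = 3 ∨ v = 3 then 2 else 1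
  weight_symm u v := by simp only [or_comm]
  weight_pos u v _ := by split_ifs <;> norm_num

end WeightedGraph

namespace BetweennessStructure

/-- `B` is isomorphic to the structure induced by one of the eight small exceptional graphs:
`K₃`; `K_{1,3}` and a weighted `C₄`; `K_{2,3}`; the six-cycle with none, one, two or all three
(the last being `K_{3,3}`) of its long diagonals. -/
def IsSmallException {X : Type*} (B : BetweennessStructure X) : Prop :=
  B.Iso (WeightedGraph.ofSimple (⊤ : SimpleGraph (Fin 3))).betweenness ∨
  B.Iso (WeightedGraph.ofSimple (completeBipartiteGraph (Fin 1) (Fin 3))).betweenness ∨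
  B.Iso WeightedGraph.weightedC4.betweenness ∨
  B.Iso (WeightedGraph.ofSimple (completeBipartiteGraph (Fin 2) (Fin 3))).betweenness ∨
  B.Iso (WeightedGraph.ofSimple (SimpleGraph.cycleGraph 6)).betweenness ∨
  B.Iso (WeightedGraph.ofSimple
    (SimpleGraph.cycleGraph 6 ⊔ SimpleGraph.edge 0 3)).betweenness ∨
  B.Iso (WeightedGraph.ofSimple
    (SimpleGraph.cycleGraph 6 ⊔ SimpleGraph.edge 0 3 ⊔ SimpleGraph.edge 1 4)).betweenness ∨
  B.Iso (WeightedGraph.ofSimple (completeBipartiteGraph (Fin 3) (Fin 3))).betweenness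

end BetweennessStructure

/-! The proof rests on linearity. At least five points without a triangle are linearly ordered
(`AlmostMetrizable.exists_order`): the only obstruction to an order is four points related as on a
square, and a fifth point excludes it.

The lower bound is an induction that deletes points (`AlmostMetrizable.card_le_of_triangle`). Six
points never carry exactly one triangle, so they carry at least two as soon as they carry one.
Beyond six points, deleting a point of a triangle loses that triangle and, if another triangle
survives, lowers the order by only one. Hence order `n ≥ 6` with a triangle forces at least `n - 4`
triangles. The families `R⁴` and `S⁴` attain this.

Suppose equality holds. For `n ≥ 7`, a point in two triangles lies in all of them, since otherwise
deleting it would violate the bound. The triangles therefore form a sunflower, and counting shows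
that its core has at least two points, except for one case with `n = 7`, which is excluded by
search. For `n = 6` the two triangles share two points or are disjoint.

Let `y` and `z` lie in all triangles. Deleting either one leaves a linear structure, so `B` is
described by two orders that agree on the common points (`TwoOrders`), together with the triples
that contain both `y` and `z`. Exactly two further points are collinear with `y` and `z`. If some
point separates `y` from `z` in the orders, then all points do, the two collinear points are the
ends, and the structure is that of `S⁴`. Otherwise `y` and `z` occupy the same place, the two
collinear points are its neighbours, and the structure is that of `R⁴`.

Orders at most five, two disjoint triangles on six points, and the impossible small configurations
are settled by exhaustive search over the middle points of the collinear triples, pruned by the four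
relations property. -/

namespace BetweennessStructure

/-! ### Collinearity, triangles and isomorphisms -/

variable {X Y : Type*} {B : BetweennessStructure X} {C : BetweennessStructure Y}

/-- Three points are collinear if one of them is between the other two. -/
def Col (B : BetweennessStructure X) (x y z : X) : Prop :=
  B.rel x y z ∨ B.rel y x z ∨ B.rel x z y

namespace AlmostMetrizable

theorem right (h : B.AlmostMetrizable) (x z : X) : B.rel x z z := h.p2 _ _ _ (h.p1 z x)

theorem eq_of_rel_self (h : B.AlmostMetrizable) {x y : X} (hxy : B.rel x y x) : x = y :=
  h.p3 x y x hxy (h.right y x)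

/-- At most one of three distinct points is between the other two. -/
theorem not_rel_left (h : B.AlmostMetrizable) {x y z : X} (hxy : x ≠ y) (hr : B.rel x y z) :
    ¬ B.rel y x z := fun h' => hxy (h.p3 _ _ _ hr h')

theorem not_rel_right (h : B.AlmostMetrizable) {x y z : X} (hyz : y ≠ z) (hr : B.rel x y z) :
    ¬ B.rel x z y := fun h' =>
  hyz ((h.p3 _ _ _ (h.p2 _ _ _ hr) (h.p2 _ _ _ h')).symm)

theorem col_swap_left (h : B.AlmostMetrizable) {x y z : X} (hc : B.Col x y z) : B.Col y x z := by
  have := h.p2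
  unfold Col at *
  tauto

theorem col_swap_right (h : B.AlmostMetrizable) {x y z : X} (hc : B.Col x y z) : B.Col x z y := by
  have := h.p2
  unfold Col at *
  tauto

theorem isTriangle_triple [DecidableEq X] (h : B.AlmostMetrizable) {x y z : X}
    (hxy : x ≠ y) (hyz : y ≠ z) (hxz : x ≠ z) : B.IsTriangle {x, y, z} ↔ ¬ B.Col x y z := by
  constructor
  · rintro ⟨-, hT⟩ (hc | hc | hc)
    · exact hT x (by simp) y (by simp) z (by simp) hxy hyz hxz hc
    · exact hT y (by simp) x (by simp) z (by simp) hxy.symm hxz hyz hc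
    · exact hT x (by simp) z (by simp) y (by simp) hxz hyz.symm hxy hc
  · intro hc
    refine ⟨Finset.card_eq_three.2 ⟨x, y, z, hxy, hxz, hyz, rfl⟩, ?_⟩
    have := h.p2
    unfold Col at hc
    simp only [Finset.mem_insert, Finset.mem_singleton]
    rintro a (rfl | rfl | rfl) b (rfl | rfl | rfl) c (rfl | rfl | rfl) hab hbc hac hr <;>
      first
      | exact absurd rfl hab
      | exact absurd rfl hbc
      | exact absurd rfl hac
      | tauto

end AlmostMetrizable

theorem IsTriangle.exists_triple [DecidableEq X] {T : Finset X} (hT : B.IsTriangle T) :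
    ∃ x y z, x ≠ y ∧ y ≠ z ∧ x ≠ z ∧ ¬ B.Col x y z ∧ T = {x, y, z} := by
  obtain ⟨x, y, z, hxy, hxz, hyz, rfl⟩ := Finset.card_eq_three.1 hT.1
  refine ⟨x, y, z, hxy, hyz, hxz, ?_, rfl⟩
  rintro (hc | hc | hc)
  · exact hT.2 x (by simp) y (by simp) z (by simp) hxy hyz hxz hc
  · exact hT.2 y (by simp) x (by simp) z (by simp) hxy.symm hxz hyz hc
  · exact hT.2 x (by simp) z (by simp) y (by simp) hxz hyz.symm hxy hc

/-- A triangle that contains two given points is obtained by adding a third. -/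
theorem IsTriangle.exists_third [DecidableEq X] {T : Finset X} (hT : B.IsTriangle T) {y z : X}
    (hyz : y ≠ z) (hy : y ∈ T) (hz : z ∈ T) : ∃ w, w ≠ y ∧ w ≠ z ∧ T = {y, z, w} := by
  have hc : ((T.erase y).erase z).card = 1 := by
    rw [Finset.card_erase_of_mem (Finset.mem_erase.2 ⟨hyz.symm, hz⟩), Finset.card_erase_of_mem hy,
      hT.1]
  obtain ⟨w, hw⟩ := Finset.card_eq_one.1 hc
  have hw' : w ∈ (T.erase y).erase z := hw ▸ Finset.mem_singleton_self w
  simp only [Finset.mem_erase] at hw'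
  refine ⟨w, hw'.2.1, hw'.1, ?_⟩
  rw [← hw, Finset.insert_erase (Finset.mem_erase.2 ⟨hyz.symm, hz⟩), Finset.insert_erase hy]

/-- A bijection that preserves the betweennesses and the triangles of an almost-metrizable
structure is an isomorphism. -/
theorem Iso.of_equiv (hB : B.AlmostMetrizable) (hC : C.AlmostMetrizable) (e : Y ≃ X)
    (hrel : ∀ u v w, u ≠ v → v ≠ w → u ≠ w → C.rel u v w → B.rel (e u) (e v) (e w))
    (htri : ∀ u v w, u ≠ v → v ≠ w → u ≠ w → ¬ C.Col u v w → ¬ B.Col (e u) (e v) (e w)) :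
    B.Iso C := by
  have key : ∀ u v w, C.rel u v w ↔ B.rel (e u) (e v) (e w) := by
    intro u v w
    by_cases huv : u = v
    · subst huv; exact iff_of_true (hC.p1 _ _) (hB.p1 _ _)
    by_cases hvw : v = w
    · subst hvw; exact iff_of_true (hC.right _ _) (hB.right _ _)
    by_cases huw : u = w
    · subst huw
      exact iff_of_false (fun h => huv (hC.eq_of_rel_self h))
        (fun h => huv (e.injective (hB.eq_of_rel_self h)))
    refine ⟨hrel u v w huv hvw huw, fun h => ?_⟩
    by_contra hn
    -- Some ordering of the triple holds in `C`, because triangles are preserved. Any ordering other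
    -- than the wanted one would carry over to `B` and give the triple a second middle point.
    have hcol : C.Col u v w := by
      by_contra hc
      exact htri u v w huv hvw huw hc (Or.inl h)
    rcases hcol with hc | hc | hc
    · exact hn hc
    · exact hB.not_rel_left (e.injective.ne huv) h (hrel _ _ _ (Ne.symm huv) huw hvw hc)
    · exact hB.not_rel_right (e.injective.ne hvw) h (hrel _ _ _ huw (Ne.symm hvw) huv hc)
  refine ⟨e.symm, fun x y z => ?_⟩
  simp [key]

theorem Iso.trans {Z : Type*} {D : BetweennessStructure Z} (h : B.Iso C) (h' : C.Iso D) :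
    B.Iso D := by
  obtain ⟨e, he⟩ := h
  obtain ⟨e', he'⟩ := h'
  exact ⟨e.trans e', fun x y z => by simp [he, he']⟩

theorem Iso.almostMetrizable (h : B.Iso C) (hC : C.AlmostMetrizable) : B.AlmostMetrizable := by
  obtain ⟨e, he⟩ := h
  refine ⟨fun x z => ?_, fun x y z => ?_, fun x y z => ?_, fun x y z w => ?_⟩ <;>
    simp only [he]
  · exact hC.p1 _ _
  · exact hC.p2 _ _ _
  · exact fun h1 h2 => e.injective (hC.p3 _ _ _ h1 h2)
  · exact hC.p4 _ _ _ _

theorem Iso.coSize_eq (h : B.Iso C) : B.coSize = C.coSize := by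
  obtain ⟨e, he⟩ := h
  unfold coSize
  rw [← Set.ncard_image_of_injective {T : Finset X | B.IsTriangle T}
    (Finset.map_injective e.toEmbedding)]
  congr 1
  ext T
  simp only [Set.mem_image, Set.mem_ofPred_eq]
  constructor
  · rintro ⟨S, hS, rfl⟩
    refine ⟨by rw [Finset.card_map, hS.1], ?_⟩
    intro x hx y hy z hz
    simpa [he] using hS.2 (e.symm x) (by simpa using hx) (e.symm y) (by simpa using hy)
      (e.symm z) (by simpa using hz)
  · rintro hT
    refine ⟨T.map e.symm.toEmbedding, ⟨by rw [Finset.card_map, hT.1], ?_⟩, ?_⟩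
    · intro x hx y hy z hz
      simpa [he] using hT.2 (e x) (by simpa using hx) (e y) (by simpa using hy)
        (e z) (by simpa using hz)
    · ext x; simp

end BetweennessStructure

/-! ### Exhaustive search on at most six points, and its soundness -/

namespace BetweennessStructure
namespace Search

/-- The position of the triple `(x, y, z)` of numbers below `6` in a bit mask. -/
def pos (x y z : ℕ) : ℕ := Nat.add (Nat.mul 36 x) (Nat.add (Nat.mul 6 y) z)

/-- Built from `Nat.land`, `Nat.shiftRight` and `Nat.beq`, which the kernel evaluates directly on
numerals, so that `decide +kernel` can run the search. -/
def bit (s x y z : ℕ) : Bool := Nat.beq (Nat.land 1 (Nat.shiftRight s (pos x y z))) 1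

/-- The mask of the two triples `(x, y, z)` and `(z, y, x)`. -/
def mask (x y z : ℕ) : ℕ := Nat.lor (Nat.shiftLeft 1 (pos x y z)) (Nat.shiftLeft 1 (pos z y x))

/-- The masks `s` (triples in the relation) and `t` (triples not in the relation) contradict
the four relations property at `x y z w`. -/
def conflict (t s x y z w : ℕ) : Bool :=
  bit s x y z && (bit s x w y &&
    (bit s w x z || (bit s x z w || (bit t x w z ||
      (bit s y w z || (bit s w z y || bit t w y z))))))

/-- Whether one of the chains on `x`, `y`, `z`, `w` in which `y` is between `x` and `z` is
contradictory. -/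
def conflictMid (t s x y z w : ℕ) : Bool :=
  bit s x y z && (conflict t s x y z w || conflict t s z y x w)

/-- Whether the known triples on `a`, `b`, `c`, `d` are contradictory. -/
def conflictFour (t s a b c d : ℕ) : Bool :=
  conflictMid t s a b c d || (conflictMid t s b a c d || (conflictMid t s a c b d ||
  (conflictMid t s a b d c || (conflictMid t s b a d c || (conflictMid t s a d b c ||
  (conflictMid t s a d c b || (conflictMid t s d a c b || (conflictMid t s a c d b ||
  (conflictMid t s d b c a || (conflictMid t s b d c a || conflictMid t s d c b a))))))))))

/-- Whether the known triples on `a`, `b`, `c` and a further point are contradictory. -/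
def conflictAt (n t s a b c : ℕ) : Bool :=
  (List.range n).any fun w =>
    !(Nat.beq w a || (Nat.beq w b || Nat.beq w c)) && conflictFour t s a b c w

/-- Search through all ways to choose, for each of the given triples, the middle point. -/
def search (n t : ℕ) (final : ℕ → Bool) : List (ℕ × ℕ × ℕ) → ℕ → Bool
  | [], s => final s
  | (a, b, c) :: l, s =>
    [mask b a c, mask a b c, mask a c b].all fun m =>
      conflictAt n t (Nat.lor s m) a b c || search n t final l (Nat.lor s m)

/-- The triples `a < b < c < n` that are not listed. -/
def triples (n : ℕ) (tri : List (ℕ × ℕ × ℕ)) : List (ℕ × ℕ × ℕ) :=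
  -- The largest point varies slowest: all triples on the first points are decided, and
  -- contradictory branches cut, before a new point enters.
  (List.range n).flatMap fun c => (List.range c).flatMap fun b => (List.range b).flatMap fun a =>
    if tri.contains (a, b, c) then [] else [(a, b, c)]

/-- The mask of all orderings of the given triples. -/
def triMask (tri : List (ℕ × ℕ × ℕ)) : ℕ :=
  tri.foldr (fun t s =>
    mask t.2.1 t.1 t.2.2 ||| (mask t.1 t.2.1 t.2.2 ||| (mask t.1 t.2.2 t.2.1 ||| s))) 0

/-- Whether all ways to complete `s` on the triples that are not listed pass the final test. -/
def check (n : ℕ) (tri : List (ℕ × ℕ × ℕ)) (s : ℕ) (final : ℕ → ℕ → Bool) : Bool :=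
  search n (triMask tri) (final (triMask tri)) (triples n tri) s

/-- Whether the betweennesses and triangles of the distance table `g` on the numbers below `n`
are recorded in the masks `s` and `t`. -/
def agrees (n : ℕ) (g : ℕ → ℕ → ℕ) (t s : ℕ) : Bool :=
  (List.range n).all fun x => (List.range n).all fun y => (List.range n).all fun z =>
    Nat.beq x y || (Nat.beq y z || (Nat.beq x z ||
      bif Nat.beq (g x z) (g x y + g y z) then bit s x y z
      else (bit t x y z || (Nat.beq (g y z) (g y x + g x z) || Nat.beq (g x y) (g x z + g z y)))))

/-- Whether `s` and `t` describe one of the distance tables after one of the relabellings. -/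
def isModel (n : ℕ) (labels : List (List ℕ)) (tables : List (ℕ → ℕ → ℕ)) (t s : ℕ) : Bool :=
  labels.any fun l => tables.any fun g => agrees n (fun i j => g (l.getD i 0) (l.getD j 0)) t s

theorem bit_eq (s x y z : ℕ) : bit s x y z = s.testBit (36 * x + (6 * y + z)) := by
  have h : ∀ a : ℕ, a < 2 → Nat.beq a 1 = (a != 0) := by decide
  have h1 : ∀ k, 1 &&& k < 2 := fun k => lt_of_le_of_lt Nat.and_le_left (by norm_num)
  exact h _ (h1 (s >>> (36 * x + (6 * y + z))))

theorem bit_lor (s m x y z : ℕ) : bit (Nat.lor s m) x y z = (bit s x y z || bit m x y z) := by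
  simp only [bit_eq]
  exact Nat.testBit_or s m _

theorem bit_zero (x y z : ℕ) : bit 0 x y z = false := by
  rw [bit_eq]; exact Nat.zero_testBit _

/-- A position is a number in base six, so its digits determine the triple; the leading digit `x`
needs no bound. -/
theorem bit_mask {a b c x y z : ℕ} (ha : a < 6) (hb : b < 6) (hc : c < 6) (hy : y < 6)
    (hz : z < 6) (h : bit (mask a b c) x y z = true) :
    (x = a ∧ y = b ∧ z = c) ∨ (x = c ∧ y = b ∧ z = a) := by
  have hsh : ∀ k i, (Nat.shiftLeft 1 k).testBit i = true → i = k := by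
    intro k i h
    have h' : (1 <<< k).testBit i = true := h
    rw [Nat.one_shiftLeft, Nat.testBit_two_pow] at h'
    simpa using (of_decide_eq_true h').symm
  rw [mask, bit_lor, Bool.or_eq_true] at h
  rcases h with h | h
  · rw [bit_eq] at h
    have := hsh _ _ h
    simp only [pos, Nat.add_eq, Nat.mul_eq] at this
    omega
  · rw [bit_eq] at h
    have := hsh _ _ h
    simp only [pos, Nat.add_eq, Nat.mul_eq] at this
    omega

variable {X : Type*} {B : BetweennessStructure X} {pt : ℕ → X} {n : ℕ}

/-- All triples recorded in `s` are in the relation. -/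
def Sound (B : BetweennessStructure X) (pt : ℕ → X) (n s : ℕ) : Prop :=
  ∀ x y z, x < n → y < n → z < n → bit s x y z = true →
    x ≠ y ∧ y ≠ z ∧ x ≠ z ∧ B.rel (pt x) (pt y) (pt z)

/-- All triples recorded in `t` are triangles. -/
def NegSound (B : BetweennessStructure X) (pt : ℕ → X) (n t : ℕ) : Prop :=
  ∀ x y z, x < n → y < n → z < n → bit t x y z = true → ¬ B.Col (pt x) (pt y) (pt z)

theorem Sound.zero : Sound B pt n 0 := fun x y z _ _ _ h => by simp [bit_zero] at h

theorem Sound.lor {s m : ℕ} (hs : Sound B pt n s) (hm : Sound B pt n m) :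
    Sound B pt n (Nat.lor s m) := by
  intro x y z hx hy hz h
  rw [bit_lor, Bool.or_eq_true] at h
  exact h.elim (hs x y z hx hy hz) (hm x y z hx hy hz)

theorem Sound.mask (hB : B.AlmostMetrizable) (hn : n ≤ 6) {a b c : ℕ} (ha : a < n) (hb : b < n)
    (hc : c < n) (hab : a ≠ b) (hbc : b ≠ c) (hac : a ≠ c) (h : B.rel (pt a) (pt b) (pt c)) :
    Sound B pt n (mask a b c) := by
  intro x y z hx hy hz hxyz
  rcases bit_mask (by omega) (by omega) (by omega) (by omega) (by omega) hxyz with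
    ⟨rfl, rfl, rfl⟩ | ⟨rfl, rfl, rfl⟩
  · exact ⟨hab, hbc, hac, h⟩
  · exact ⟨hbc.symm, hab.symm, hac.symm, hB.p2 _ _ _ h⟩

/-- The four relations property puts `w` between `x` and `z`, and `y` between `w` and `z`. Each
alternative in `conflict` gives one of these triples a second middle point or makes it a triangle.
-/
theorem conflict_eq_false (hB : B.AlmostMetrizable)
    (hinj : ∀ i < n, ∀ j < n, pt i = pt j → i = j) {s t : ℕ} (hs : Sound B pt n s)
    (ht : NegSound B pt n t) {x y z w : ℕ} (hx : x < n) (hy : y < n) (hz : z < n) (hw : w < n) :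
    conflict t s x y z w = false := by
  rw [← Bool.not_eq_true]
  intro h
  simp only [conflict, Bool.and_eq_true, Bool.or_eq_true] at h
  obtain ⟨h1, h2, h3⟩ := h
  obtain ⟨hxy, hyz, hxz, r1⟩ := hs _ _ _ hx hy hz h1
  obtain ⟨hxw, hwy, -, r2⟩ := hs _ _ _ hx hw hy h2
  obtain ⟨r3, r4⟩ := hB.p4 _ _ _ _ r1 r2
  have hne : ∀ {i j}, i < n → j < n → i ≠ j → pt i ≠ pt j := fun hi hj hij h =>
    hij (hinj _ hi _ hj h)
  rcases h3 with h3 | h3 | h3 | h3 | h3 | h3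
  · exact hB.not_rel_left (hne hx hw hxw) r3 (hs _ _ _ hw hx hz h3).2.2.2
  · obtain ⟨-, hzw, -, r5⟩ := hs _ _ _ hx hz hw h3
    exact hB.not_rel_right (hne hw hz hzw.symm) r3 r5
  · exact ht _ _ _ hx hw hz h3 (Or.inl r3)
  · exact hB.not_rel_left (hne hw hy hwy) r4 (hs _ _ _ hy hw hz h3).2.2.2
  · exact hB.not_rel_right (hne hy hz hyz) r4 (hs _ _ _ hw hz hy h3).2.2.2
  · exact ht _ _ _ hw hy hz h3 (Or.inl r4)

theorem conflictAt_eq_false (hB : B.AlmostMetrizable)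
    (hinj : ∀ i < n, ∀ j < n, pt i = pt j → i = j) {s t : ℕ} (hs : Sound B pt n s)
    (ht : NegSound B pt n t) {a b c : ℕ} (ha : a < n) (hb : b < n) (hc : c < n) :
    conflictAt n t s a b c = false := by
  rw [← Bool.not_eq_true, conflictAt, List.any_eq_true]
  rintro ⟨w, hw, h⟩
  rw [List.mem_range] at hw
  have key : ∀ x y z w, x < n → y < n → z < n → w < n → conflictMid t s x y z w = false := by
    intro x y z w hx hy hz hw
    rw [conflictMid, conflict_eq_false hB hinj hs ht hx hy hz hw,
      conflict_eq_false hB hinj hs ht hz hy hx hw, Bool.or_self, Bool.and_false]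
  simp [conflictFour, key, ha, hb, hc, hw] at h

/-- The actual structure selects a branch: at every triple its true middle point gives a sound
extension, and sound masks are never in conflict. This branch is therefore not cut, and its end
passes the final test. -/
theorem exists_of_search (hB : B.AlmostMetrizable)
    (hinj : ∀ i < n, ∀ j < n, pt i = pt j → i = j) (hn : n ≤ 6) {t : ℕ}
    (ht : NegSound B pt n t) {final : ℕ → Bool} (l : List (ℕ × ℕ × ℕ))
    (hl : ∀ p ∈ l, p.1 < p.2.1 ∧ p.2.1 < p.2.2 ∧ p.2.2 < n ∧ B.Col (pt p.1) (pt p.2.1) (pt p.2.2))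
    {s : ℕ} (hs : Sound B pt n s) (h : search n t final l s = true) :
    ∃ s', Sound B pt n s' ∧ final s' = true := by
  induction l generalizing s with
  | nil => exact ⟨s, hs, h⟩
  | cons p l ih =>
    obtain ⟨a, b, c⟩ := p
    obtain ⟨hab, hbc, hc, hcol⟩ := hl _ List.mem_cons_self
    simp only at hab hbc hc hcol
    have step : ∀ m, Sound B pt n m →
        (conflictAt n t (Nat.lor s m) a b c || search n t final l (Nat.lor s m)) = true →
        ∃ s', Sound B pt n s' ∧ final s' = true := by
      intro m hm h
      have hsm := hs.lor hm
      rw [conflictAt_eq_false hB hinj hsm ht (by omega) (by omega) hc, Bool.false_or] at h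
      exact ih (fun p hp => hl p (List.mem_cons_of_mem _ hp)) hsm h
    simp only [search, List.all_cons, List.all_nil, Bool.and_true, Bool.and_eq_true] at h
    rcases hcol with hcol | hcol | hcol
    · exact step _ (Sound.mask hB hn (by omega) (by omega) (by omega) (by omega) (by omega)
        (by omega) hcol) h.2.1
    · exact step _ (Sound.mask hB hn (by omega) (by omega) (by omega) (by omega) (by omega)
        (by omega) hcol) h.1
    · exact step _ (Sound.mask hB hn (by omega) (by omega) (by omega) (by omega) (by omega)
        (by omega) hcol) h.2.2

theorem negSound_triMask (hB : B.AlmostMetrizable) (hn : n ≤ 6) (tri : List (ℕ × ℕ × ℕ))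
    (htri : ∀ p ∈ tri, p.1 < n ∧ p.2.1 < n ∧ p.2.2 < n ∧
      ¬ B.Col (pt p.1) (pt p.2.1) (pt p.2.2)) : NegSound B pt n (triMask tri) := by
  induction tri with
  | nil => exact fun x y z _ _ _ h => by simp [triMask, bit_zero] at h
  | cons p tri ih =>
    intro x y z hx hy hz h
    obtain ⟨h1, h2, h3, hcol⟩ := htri _ List.mem_cons_self
    have ih' := ih (fun p hp => htri p (List.mem_cons_of_mem _ hp)) x y z hx hy hz
    rw [triMask, List.foldr_cons, ← triMask] at h
    change bit (Nat.lor _ (Nat.lor _ (Nat.lor _ _))) x y z = true at h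
    simp only [bit_lor, Bool.or_eq_true] at h
    have hL : ∀ {x y z}, B.Col x y z → B.Col y x z := hB.col_swap_left
    have hR : ∀ {x y z}, B.Col x y z → B.Col x z y := hB.col_swap_right
    rcases h with h | h | h | h
    · rcases bit_mask (by omega) (by omega) (by omega) (by omega) (by omega) h with
        ⟨rfl, rfl, rfl⟩ | ⟨rfl, rfl, rfl⟩
      · exact fun h => hcol (hL h)
      · exact fun h => hcol (hR (hL h))
    · rcases bit_mask (by omega) (by omega) (by omega) (by omega) (by omega) h with
        ⟨rfl, rfl, rfl⟩ | ⟨rfl, rfl, rfl⟩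
      · exact hcol
      · exact fun h => hcol (hL (hR (hL h)))
    · rcases bit_mask (by omega) (by omega) (by omega) (by omega) (by omega) h with
        ⟨rfl, rfl, rfl⟩ | ⟨rfl, rfl, rfl⟩
      · exact fun h => hcol (hR h)
      · exact fun h => hcol (hL (hR h))
    · exact ih' h

theorem mem_triples {tri : List (ℕ × ℕ × ℕ)} {p : ℕ × ℕ × ℕ} (h : p ∈ triples n tri) :
    p.1 < p.2.1 ∧ p.2.1 < p.2.2 ∧ p.2.2 < n ∧ p ∉ tri := by
  simp only [triples, List.mem_flatMap, List.mem_range] at h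
  obtain ⟨c, hc, b, hb, a, ha, h⟩ := h
  split_ifs at h with hcon
  · simp at h
  · rw [List.mem_singleton] at h
    subst h
    exact ⟨ha, hb, hc, by simpa using hcon⟩

/-- A successful search shows that the points `pt 0, …, pt (n - 1)`, of which exactly the listed
triples are triangles, satisfy the final test. -/
theorem exists_of_check (hB : B.AlmostMetrizable)
    (hinj : ∀ i < n, ∀ j < n, pt i = pt j → i = j) (hn : n ≤ 6) {tri : List (ℕ × ℕ × ℕ)}
    (hlt : ∀ p ∈ tri, p.1 < n ∧ p.2.1 < n ∧ p.2.2 < n)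
    (htri : ∀ p ∈ tri, ¬ B.Col (pt p.1) (pt p.2.1) (pt p.2.2))
    (hcol : ∀ a b c, a < b → b < c → c < n → (a, b, c) ∉ tri → B.Col (pt a) (pt b) (pt c))
    {s : ℕ} (hs : Sound B pt n s) {final : ℕ → ℕ → Bool} (h : check n tri s final = true) :
    ∃ s t, Sound B pt n s ∧ NegSound B pt n t ∧ final t s = true := by
  have ht := negSound_triMask hB hn tri fun p hp =>
    ⟨(hlt p hp).1, (hlt p hp).2.1, (hlt p hp).2.2, htri p hp⟩
  obtain ⟨s', hs', h'⟩ := exists_of_search hB hinj hn ht _ (fun p hp => by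
    obtain ⟨h1, h2, h3, h4⟩ := mem_triples hp
    exact ⟨h1, h2, h3, hcol _ _ _ h1 h2 h3 h4⟩) hs h
  exact ⟨s', _, hs', ht, h'⟩

/-- After relabelling, `agrees` says that betweennesses of the table hold in `B` and triangles of
the table are triangles of `B`, which is what `Iso.of_equiv` needs. Quantifying over all `C` that
realize the table keeps the search independent of the vertex types of the graphs. -/
theorem exists_iso_of_isModel (hB : B.AlmostMetrizable)
    (hbij : Function.Bijective fun i : Fin n => pt i) {labels : List (List ℕ)}
    (hlab : ∀ l ∈ labels, l.Perm (List.range n)) {tables : List (ℕ → ℕ → ℕ)} {s t : ℕ}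
    (hs : Sound B pt n s) (ht : NegSound B pt n t) (h : isModel n labels tables t s = true) :
    ∃ g ∈ tables, ∀ (V : Type) (C : BetweennessStructure V) (idx : V ≃ Fin n),
      C.AlmostMetrizable →
      (∀ u v w, C.rel u v w ↔ g (idx u) (idx w) = g (idx u) (idx v) + g (idx v) (idx w)) →
      B.Iso C := by
  simp only [isModel, List.any_eq_true] at h
  obtain ⟨l, hl, g, hg, h⟩ := h
  refine ⟨g, hg, fun V C idx hC hrel => ?_⟩
  have hperm := hlab l hl
  have hlen : l.length = n := by simpa using hperm.length_eq
  have hnd : l.Nodup := hperm.nodup_iff.2 List.nodup_range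
  have hlt : ∀ i : Fin n, l.getD i 0 < n := by
    intro i
    rw [List.getD_eq_getElem _ _ (by omega)]
    exact List.mem_range.1 (hperm.subset (List.getElem_mem _))
  let p : Fin n → Fin n := fun i => ⟨l.getD i 0, hlt i⟩
  have hp : Function.Injective p := by
    intro i j hij
    have h1 : l.getD i 0 = l.getD j 0 := congrArg Fin.val hij
    rw [List.getD_eq_getElem _ _ (by omega), List.getD_eq_getElem _ _ (by omega)] at h1
    exact Fin.ext ((List.Nodup.getElem_inj_iff hnd).1 h1)
  let σ : Fin n ≃ Fin n := Equiv.ofBijective p (Finite.injective_iff_bijective.1 hp)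
  let e : Fin n ≃ X := Equiv.ofBijective _ hbij
  have hag : ∀ x y z : Fin n, x ≠ y → y ≠ z → x ≠ z →
      (g (σ x) (σ z) = g (σ x) (σ y) + g (σ y) (σ z) → B.rel (e x) (e y) (e z)) ∧
      (B.Col (e x) (e y) (e z) → g (σ x) (σ z) = g (σ x) (σ y) + g (σ y) (σ z) ∨
        g (σ y) (σ z) = g (σ y) (σ x) + g (σ x) (σ z) ∨
        g (σ x) (σ y) = g (σ x) (σ z) + g (σ z) (σ y)) := by
    intro x y z hxy hyz hxz
    have h' := h
    simp only [agrees, List.all_eq_true, List.mem_range] at h'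
    have h1 := h' x x.2 y y.2 z z.2
    simp only [Nat.beq_eq, Bool.or_eq_true, Fin.val_inj, hxy, hyz, hxz, false_or] at h1
    have hσ : ∀ i : Fin n, ((σ i : Fin n) : ℕ) = l.getD i 0 := fun i => rfl
    simp only [hσ]
    by_cases hb : g (l.getD x 0) (l.getD z 0) =
        g (l.getD x 0) (l.getD y 0) + g (l.getD y 0) (l.getD z 0)
    · rw [← Nat.beq_eq] at hb
      rw [hb, cond_true] at h1
      exact ⟨fun _ => (hs x y z x.2 y.2 z.2 h1).2.2.2, fun _ => Or.inl (by rwa [Nat.beq_eq] at hb)⟩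
    · refine ⟨fun h => absurd h hb, fun hcol => Or.inr ?_⟩
      rw [← Nat.beq_eq, Bool.not_eq_true] at hb
      rw [hb, cond_false] at h1
      simp only [Bool.or_eq_true, Nat.beq_eq] at h1
      rcases h1 with h1 | h1
      · exact absurd hcol (ht x y z x.2 y.2 z.2 h1)
      · exact h1
  -- From vertices to indices of the table, back through the relabelling to the numbers of the
  -- search, and on to the points of `B`.
  refine Iso.of_equiv hB hC ((idx.trans σ.symm).trans e) (fun u v w huv hvw huw h1 => ?_)
    (fun u v w huv hvw huw h1 h2 => h1 ?_)
  · refine (hag _ _ _ ?_ ?_ ?_).1 ?_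
    · simpa using huv
    · simpa using hvw
    · simpa using huw
    · simpa using (hrel u v w).1 h1
  · have := (hag _ _ _ (by simpa using huv) (by simpa using hvw) (by simpa using huw)).2 h2
    simpa [Col, hrel] using this

end Search
end BetweennessStructure

/-! ### Distance tables of the small models and the finite checks -/

namespace BetweennessStructure
namespace Search

def table (rows : List (List ℕ)) (i j : ℕ) : ℕ := (rows.getD i []).getD j 0

def distK3 : ℕ → ℕ → ℕ := table [[0, 1, 1], [1, 0, 1], [1, 1, 0]]
def distK13 : ℕ → ℕ → ℕ := table [[0, 1, 1, 1], [1, 0, 2, 2], [1, 2, 0, 2], [1, 2, 2, 0]]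
def distC4 : ℕ → ℕ → ℕ := table [[0, 1, 2, 2], [1, 0, 1, 3], [2, 1, 0, 2], [2, 3, 2, 0]]
def distK23 : ℕ → ℕ → ℕ := table
  [[0, 2, 1, 1, 1], [2, 0, 1, 1, 1], [1, 1, 0, 2, 2], [1, 1, 2, 0, 2], [1, 1, 2, 2, 0]]
-- The rows are `x₁, x₂, x₃, y, z` of `R⁴_{5,1}`; `distS4` lists the vertices of `S⁴_5` in the same
-- order.
def distR4 : ℕ → ℕ → ℕ := table
  [[0, 2, 3, 1, 1], [2, 0, 1, 1, 1], [3, 1, 0, 2, 2], [1, 1, 2, 0, 2], [1, 1, 2, 2, 0]]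
def distS4 : ℕ → ℕ → ℕ := table
  [[0, 1, 2, 1, 3], [1, 0, 1, 2, 2], [2, 1, 0, 3, 1], [1, 2, 3, 0, 2], [3, 2, 1, 2, 0]]
def distC6 : ℕ → ℕ → ℕ := table [[0, 1, 2, 3, 2, 1], [1, 0, 1, 2, 3, 2], [2, 1, 0, 1, 2, 3],
  [3, 2, 1, 0, 1, 2], [2, 3, 2, 1, 0, 1], [1, 2, 3, 2, 1, 0]]
def distC6OneDiagonal : ℕ → ℕ → ℕ := table [[0, 1, 2, 1, 2, 1], [1, 0, 1, 2, 3, 2],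
  [2, 1, 0, 1, 2, 3], [1, 2, 1, 0, 1, 2], [2, 3, 2, 1, 0, 1], [1, 2, 3, 2, 1, 0]]
def distC6TwoDiagonals : ℕ → ℕ → ℕ := table [[0, 1, 2, 1, 2, 1], [1, 0, 1, 2, 1, 2],
  [2, 1, 0, 1, 2, 3], [1, 2, 1, 0, 1, 2], [2, 1, 2, 1, 0, 1], [1, 2, 3, 2, 1, 0]]
def distK33 : ℕ → ℕ → ℕ := table [[0, 1, 2, 1, 2, 1], [1, 0, 1, 2, 1, 2],
  [2, 1, 0, 1, 2, 1], [1, 2, 1, 0, 1, 2], [2, 1, 2, 1, 0, 1], [1, 2, 1, 2, 1, 0]]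

/-- The relabellings of `0, …, 5` that map `{0, 1, 2}` to `{0, 2, 4}` and
`{3, 4, 5}` to `{1, 3, 5}`. -/
def bipartiteLabels : List (List ℕ) :=
  [0, 2, 4].permutations'.flatMap fun p => [1, 3, 5].permutations'.map fun q => p ++ q

def tablesThree : List (ℕ → ℕ → ℕ) := [distK3]
def tablesFour : List (ℕ → ℕ → ℕ) := [distK13, distC4]
def tablesFive : List (ℕ → ℕ → ℕ) := [distK23, distR4, distS4]
def tablesSix : List (ℕ → ℕ → ℕ) := [distC6, distC6OneDiagonal, distC6TwoDiagonals, distK33]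

theorem check_three : check 3 [(0, 1, 2)] 0 (isModel 3 (List.range 3).permutations' tablesThree) =
    true := by decide +kernel

theorem check_four : check 4 [(0, 1, 2)] 0 (isModel 4 (List.range 4).permutations' tablesFour) =
    true := by decide +kernel

theorem check_five : check 5 [(0, 1, 2)] 0 (isModel 5 (List.range 5).permutations' tablesFive) =
    true := by decide +kernel

/-- In all four six-point tables the triangles are `{0, 2, 4}` and `{1, 3, 5}`, so only relabellings
that match these with the two listed triangles are tried. -/
theorem check_six_disjoint :
    check 6 [(0, 1, 2), (3, 4, 5)] 0 (isModel 6 bipartiteLabels tablesSix) = true := by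
  decide +kernel

/-- The final test is constantly `false`, so success means that every branch is contradictory: no
six points have exactly one triangle. The next two checks are impossibility results of the same
kind. -/
theorem check_six_single : check 6 [(0, 1, 2)] 0 (fun _ _ => false) = true := by decide +kernel

theorem check_six_shared :
    check 6 [(0, 1, 2), (0, 3, 4)] 0 (fun _ _ => false) = true := by decide +kernel

theorem check_five_square : check 5 []
    (Nat.lor (mask 0 1 2) (Nat.lor (mask 1 2 3) (Nat.lor (mask 2 3 0) (mask 3 0 1))))
    (fun _ _ => false) = true := by decide +kernel

end Search

/-! ### From the checks to statements about triangles in arbitrary structures -/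

open Search

variable {X : Type*} {B : BetweennessStructure X}

/-- The form of `Search.exists_of_check` in which the points are given by a list and the triangles
as sets. -/
theorem AlmostMetrizable.exists_of_check [DecidableEq X] (hB : B.AlmostMetrizable) {n : ℕ}
    {l : List X} {d : X} (hl : l.Nodup) (hn : l.length = n) (hn6 : n ≤ 6)
    {tri : List (ℕ × ℕ × ℕ)} (hlt : ∀ p ∈ tri, p.1 < p.2.1 ∧ p.2.1 < p.2.2 ∧ p.2.2 < n)
    (htri : ∀ p ∈ tri, B.IsTriangle {l.getD p.1 d, l.getD p.2.1 d, l.getD p.2.2 d})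
    (huniq : ∀ T ⊆ l.toFinset, B.IsTriangle T →
      ∃ p ∈ tri, T = {l.getD p.1 d, l.getD p.2.1 d, l.getD p.2.2 d})
    {s : ℕ} (hs : Sound B (fun i => l.getD i d) n s) {final : ℕ → ℕ → Bool}
    (h : check n tri s final = true) :
    ∃ s t, Sound B (fun i => l.getD i d) n s ∧ NegSound B (fun i => l.getD i d) n t ∧
      final t s = true := by
  have hinj : ∀ i < n, ∀ j < n, l.getD i d = l.getD j d → i = j := by
    intro i hi j hj h
    rw [List.getD_eq_getElem _ _ (by omega), List.getD_eq_getElem _ _ (by omega)] at h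
    exact (List.Nodup.getElem_inj_iff hl).1 h
  refine Search.exists_of_check hB hinj hn6
    (fun p hp => ?_) (fun p hp => ?_) (fun a b c hab hbc hc habc => ?_) hs h
  · have := hlt p hp
    omega
  · have := hlt p hp
    refine (hB.isTriangle_triple ?_ ?_ ?_).1 (htri p hp)
    all_goals
      intro h
      have := hinj _ (by omega) _ (by omega) h
      omega
  · by_contra hcol
    have hmem : ∀ i < n, l.getD i d ∈ l.toFinset := by
      intro i hi
      rw [List.getD_eq_getElem _ _ (by omega), List.mem_toFinset]
      exact List.getElem_mem _
    have hT : B.IsTriangle {l.getD a d, l.getD b d, l.getD c d} := by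
      refine (hB.isTriangle_triple ?_ ?_ ?_).2 hcol
      all_goals
        intro h
        have := hinj _ (by omega) _ (by omega) h
        omega
    obtain ⟨p, hp, hpe⟩ := huniq _ (by
      intro x hx
      simp only [Finset.mem_insert, Finset.mem_singleton] at hx
      rcases hx with rfl | rfl | rfl
      · exact hmem _ (by omega)
      · exact hmem _ (by omega)
      · exact hmem _ hc) hT
    have hplt := hlt p hp
    have key : ∀ i < n, l.getD i d ∈ ({l.getD a d, l.getD b d, l.getD c d} : Finset X) →
        i = p.1 ∨ i = p.2.1 ∨ i = p.2.2 := by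
      intro i hi h
      rw [hpe] at h
      simp only [Finset.mem_insert, Finset.mem_singleton] at h
      rcases h with h | h | h
      · exact Or.inl (hinj _ hi _ (by omega) h)
      · exact Or.inr (Or.inl (hinj _ hi _ (by omega) h))
      · exact Or.inr (Or.inr (hinj _ hi _ (by omega) h))
    have ha := key a (by omega) (by simp)
    have hb := key b (by omega) (by simp)
    have hc' := key c (by omega) (by simp)
    apply habc
    have : (a, b, c) = p := by
      ext
      · change a = p.1; omega
      · change b = p.2.1; omega
      · change c = p.2.2; omega
    rwa [this]

/-- `B` is isomorphic to the structures of one of the given distance tables. -/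
def IsoTable (B : BetweennessStructure X) (n : ℕ) (tables : List (ℕ → ℕ → ℕ)) : Prop :=
  ∃ g ∈ tables, ∀ (V : Type) (C : BetweennessStructure V) (idx : V ≃ Fin n),
    C.AlmostMetrizable →
    (∀ u v w, C.rel u v w ↔ g (idx u) (idx w) = g (idx u) (idx v) + g (idx v) (idx w)) →
    B.Iso C

theorem AlmostMetrizable.isoTable [DecidableEq X] [Finite X] (hB : B.AlmostMetrizable) {n : ℕ}
    {l : List X} {d : X} (hl : l.Nodup) (hn : l.length = n) (hcard : Nat.card X = n) (hn6 : n ≤ 6)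
    {tri : List (ℕ × ℕ × ℕ)} (hlt : ∀ p ∈ tri, p.1 < p.2.1 ∧ p.2.1 < p.2.2 ∧ p.2.2 < n)
    (htri : ∀ p ∈ tri, B.IsTriangle {l.getD p.1 d, l.getD p.2.1 d, l.getD p.2.2 d})
    (huniq : ∀ T : Finset X, B.IsTriangle T →
      ∃ p ∈ tri, T = {l.getD p.1 d, l.getD p.2.1 d, l.getD p.2.2 d})
    {labels : List (List ℕ)} (hlab : ∀ l ∈ labels, l.Perm (List.range n))
    {tables : List (ℕ → ℕ → ℕ)} (h : check n tri 0 (isModel n labels tables) = true) :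
    B.IsoTable n tables := by
  obtain ⟨s, t, hs, ht, hm⟩ := hB.exists_of_check hl hn hn6 hlt htri (fun T _ => huniq T)
    Sound.zero h
  refine exists_iso_of_isModel hB ?_ hlab hs ht hm
  refine (Nat.bijective_iff_injective_and_card _).2 ⟨fun i j hij => ?_, by simp [hcard]⟩
  simp only at hij
  rw [List.getD_eq_getElem _ _ (by omega), List.getD_eq_getElem _ _ (by omega)] at hij
  exact Fin.ext ((List.Nodup.getElem_inj_iff hl).1 hij)

/-- A list of the points of `S` that starts with the points of the triangle `T`. -/
theorem exists_list_of_triangle [DecidableEq X] {S T : Finset X} (hT : B.IsTriangle T)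
    (hTS : T ⊆ S) : ∃ (l : List X) (d : X), l.Nodup ∧ l.toFinset = S ∧ l.length = S.card ∧
      T = {l.getD 0 d, l.getD 1 d, l.getD 2 d} := by
  obtain ⟨x, y, z, hxy, hyz, hxz, -, rfl⟩ := hT.exists_triple
  have hnd : ([x, y, z] ++ (S \ {x, y, z}).toList).Nodup := by
    refine List.Nodup.append (by simp [hxy, hyz, hxz]) (Finset.nodup_toList _) ?_
    intro a ha ha'
    simp only [Finset.mem_toList, Finset.mem_sdiff] at ha'
    exact ha'.2 (by simpa using ha)
  have hS : ([x, y, z] ++ (S \ {x, y, z}).toList).toFinset = S := by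
    rw [List.toFinset_append, Finset.toList_toFinset]
    have : [x, y, z].toFinset = {x, y, z} := by ext; simp
    rw [this, Finset.union_sdiff_of_subset hTS]
  refine ⟨_, x, hnd, hS, ?_, by simp⟩
  rw [← List.toFinset_card_of_nodup hnd, hS]

/-- Starts the induction for the lower bound, and also excludes a unique triangle among more than
six points, by passing to six points that contain it. -/
theorem AlmostMetrizable.exists_second_triangle [DecidableEq X] (hB : B.AlmostMetrizable)
    {S T : Finset X} (hS : S.card = 6) (hT : B.IsTriangle T) (hTS : T ⊆ S) :
    ∃ T' ⊆ S, B.IsTriangle T' ∧ T' ≠ T := by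
  by_contra! hno
  obtain ⟨l, d, hl, hlS, hlen, rfl⟩ := exists_list_of_triangle hT hTS
  obtain ⟨s, t, -, -, h⟩ := hB.exists_of_check hl (hlen.trans hS) le_rfl (d := d)
    (tri := [(0, 1, 2)]) (by simp) (by simpa using hT)
    (fun T hTl hT' => ⟨_, List.mem_singleton_self _, hno T (hlS ▸ hTl) hT'⟩)
    Sound.zero check_six_single
  simp at h

/-- Six points cannot have exactly two triangles that share a single point. This excludes the
sunflowers with a one-point core. -/
theorem AlmostMetrizable.exists_third_triangle [DecidableEq X] (hB : B.AlmostMetrizable)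
    {S T₁ T₂ : Finset X} (hS : S.card = 6) (hT₁ : B.IsTriangle T₁) (hTS₁ : T₁ ⊆ S)
    (hT₂ : B.IsTriangle T₂) (hTS₂ : T₂ ⊆ S) {v : X} (hv : T₁ ∩ T₂ = {v}) :
    ∃ T ⊆ S, B.IsTriangle T ∧ T ≠ T₁ ∧ T ≠ T₂ := by
  by_contra! hno
  have hv' : v ∈ T₁ ∩ T₂ := hv ▸ Finset.mem_singleton_self v
  rw [Finset.mem_inter] at hv'
  have pair : ∀ {T : Finset X}, B.IsTriangle T → v ∈ T → ∃ a b, a ≠ b ∧ a ≠ v ∧ b ≠ v ∧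
      T = {v, a, b} := by
    intro T hT hvT
    have h2 : (T.erase v).card = 2 := by rw [Finset.card_erase_of_mem hvT, hT.1]
    obtain ⟨a, b, hab, h⟩ := Finset.card_eq_two.1 h2
    have ha : a ∈ T.erase v := by simp [h]
    have hb : b ∈ T.erase v := by simp [h]
    exact ⟨a, b, hab, Finset.ne_of_mem_erase ha, Finset.ne_of_mem_erase hb,
      by rw [← h, Finset.insert_erase hvT]⟩
  obtain ⟨a, b, hab, hav, hbv, rfl⟩ := pair hT₁ hv'.1
  obtain ⟨c, d, hcd, hcv, hdv, rfl⟩ := pair hT₂ hv'.2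
  have hdis : ∀ x, (x = a ∨ x = b) → (x = c ∨ x = d) → False := by
    intro x hx hx'
    have : x ∈ ({v, a, b} ∩ {v, c, d} : Finset X) := by
      simp only [Finset.mem_inter, Finset.mem_insert, Finset.mem_singleton]
      tauto
    rw [hv, Finset.mem_singleton] at this
    rcases hx with rfl | rfl
    · exact hav this
    · exact hbv this
  have hac : a ≠ c := fun h => hdis a (Or.inl rfl) (Or.inl h)
  have had : a ≠ d := fun h => hdis a (Or.inl rfl) (Or.inr h)
  have hbc : b ≠ c := fun h => hdis b (Or.inr rfl) (Or.inl h)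
  have hbd : b ≠ d := fun h => hdis b (Or.inr rfl) (Or.inr h)
  have h5 : ({v, a, b, c, d} : Finset X) ⊆ S := by
    intro x hx
    simp only [Finset.mem_insert, Finset.mem_singleton] at hx
    rcases hx with rfl | rfl | rfl | rfl | rfl
    · exact hTS₁ (by simp)
    · exact hTS₁ (by simp)
    · exact hTS₁ (by simp)
    · exact hTS₂ (by simp)
    · exact hTS₂ (by simp)
  have hnd : ([v, a, b, c, d] ++ (S \ {v, a, b, c, d}).toList).Nodup := by
    refine List.Nodup.append ?_ (Finset.nodup_toList _) ?_
    · simp [hab, hcd, hac, had, hbc, hbd, hav.symm, hbv.symm, hcv.symm, hdv.symm]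
    intro x hx hx'
    simp only [Finset.mem_toList, Finset.mem_sdiff] at hx'
    exact hx'.2 (by simpa using hx)
  have hlS : ([v, a, b, c, d] ++ (S \ {v, a, b, c, d}).toList).toFinset = S := by
    rw [List.toFinset_append, Finset.toList_toFinset]
    have : [v, a, b, c, d].toFinset = {v, a, b, c, d} := by ext; simp
    rw [this, Finset.union_sdiff_of_subset h5]
  obtain ⟨s, t, -, -, h⟩ := hB.exists_of_check hnd
    (by rw [← List.toFinset_card_of_nodup hnd, hlS, hS]) le_rfl (d := v)
    (tri := [(0, 1, 2), (0, 3, 4)]) (by simp)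
    (by simpa using ⟨hT₁, hT₂⟩)
    (fun T hTl hT' => by
      by_cases h1 : T = {v, a, b}
      · exact ⟨_, List.mem_cons_self, by simpa using h1⟩
      · exact ⟨(0, 3, 4), by simp, by simpa using hno T (hlS ▸ hTl) hT' h1⟩)
    Sound.zero check_six_shared
  simp at h

/-- Four of five points without triangles do not form a square. -/
theorem AlmostMetrizable.not_square [DecidableEq X] (hB : B.AlmostMetrizable) {a b c d e : X}
    (hnd : [a, b, c, d, e].Nodup) (hno : ∀ T ⊆ [a, b, c, d, e].toFinset, ¬ B.IsTriangle T)
    (h₁ : B.rel a b c) (h₂ : B.rel b c d) (h₃ : B.rel c d a) (h₄ : B.rel d a b) : False := by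
  obtain ⟨s, t, -, -, h⟩ := hB.exists_of_check hnd rfl (d := a) (by simp) (tri := []) (by simp)
    (by simp) (fun T hT hT' => absurd hT' (hno T hT))
    ((Sound.mask hB (by simp) (by simp) (by simp) (by simp) (by simp) (by simp) (by simp)
      (by simpa using h₁)).lor
    ((Sound.mask hB (by simp) (by simp) (by simp) (by simp) (by simp) (by simp) (by simp)
      (by simpa using h₂)).lor
    ((Sound.mask hB (by simp) (by simp) (by simp) (by simp) (by simp) (by simp) (by simp)
      (by simpa using h₃)).lor
    (Sound.mask hB (by simp) (by simp) (by simp) (by simp) (by simp) (by simp) (by simp)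
      (by simpa using h₄))))) check_five_square
  simp at h

/-- The structures of order at most five with one triangle. -/
theorem AlmostMetrizable.isoTable_of_unique [DecidableEq X] [Finite X] (hB : B.AlmostMetrizable)
    {T : Finset X} (hT : B.IsTriangle T) (huniq : ∀ T', B.IsTriangle T' → T' = T) {n : ℕ}
    (hn3 : 3 ≤ n) (hn6 : n ≤ 6) (hcard : Nat.card X = n) {tables : List (ℕ → ℕ → ℕ)}
    (h : check n [(0, 1, 2)] 0 (isModel n (List.range n).permutations' tables) = true) :
    B.IsoTable n tables := by
  have := Fintype.ofFinite X
  obtain ⟨l, d, hl, -, hlen, rfl⟩ := exists_list_of_triangle hT (Finset.subset_univ T)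
  rw [Finset.card_univ, ← Nat.card_eq_fintype_card, hcard] at hlen
  refine hB.isoTable hl hlen hcard hn6 (d := d) ?_ (by simpa using hT)
    (fun T hT' => ⟨_, List.mem_singleton_self _, huniq T hT'⟩)
    (fun l hl => List.mem_permutations'.1 hl) h
  simp only [List.mem_singleton]
  rintro p rfl
  exact ⟨by simp, by simp, hn3⟩

theorem AlmostMetrizable.isoTable_of_disjoint [DecidableEq X] [Finite X] (hB : B.AlmostMetrizable)
    {T₁ T₂ : Finset X} (hT₁ : B.IsTriangle T₁) (hT₂ : B.IsTriangle T₂) (hdis : Disjoint T₁ T₂)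
    (huniq : ∀ T, B.IsTriangle T → T = T₁ ∨ T = T₂) (hcard : Nat.card X = 6) :
    B.IsoTable 6 tablesSix := by
  obtain ⟨a, b, c, hab, hbc, hac, -, rfl⟩ := hT₁.exists_triple
  obtain ⟨d, e, f, hde, hef, hdf, -, rfl⟩ := hT₂.exists_triple
  simp only [Finset.disjoint_insert_left, Finset.disjoint_singleton_left, Finset.mem_insert,
    Finset.mem_singleton, not_or] at hdis
  obtain ⟨⟨h1, h2, h3⟩, ⟨h4, h5, h6⟩, h7, h8, h9⟩ := hdis
  refine hB.isoTable (n := 6) (l := [a, b, c, d, e, f]) (d := a) (tri := [(0, 1, 2), (3, 4, 5)])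
    (by simp [*]) rfl hcard le_rfl (by simp) (by simpa using ⟨hT₁, hT₂⟩)
    (by simpa using huniq) (by decide +kernel) check_six_disjoint

end BetweennessStructure

/-! ### Structures without triangles are linear -/

namespace BetweennessStructure

variable {X : Type*} {B : BetweennessStructure X}

/-- Without triangles, a structure of order at least five is linear. -/
theorem AlmostMetrizable.exists_order (hB : B.AlmostMetrizable) {S : Finset X} (hS : 5 ≤ S.card)
    (hno : ∀ T ⊆ S, ¬ B.IsTriangle T) : ∃ f : X → ℤ, Set.InjOn f S ∧
      ∀ x ∈ S, ∀ y ∈ S, ∀ z ∈ S, f x ≤ f y → f y ≤ f z → B.rel x y z := by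
  classical
  have hcol : ∀ x ∈ S, ∀ y ∈ S, ∀ z ∈ S, x ≠ y → y ≠ z → x ≠ z → B.Col x y z := by
    intro x hx y hy z hz hxy hyz hxz
    by_contra hc
    refine hno {x, y, z} ?_ ((hB.isTriangle_triple hxy hyz hxz).2 hc)
    intro w hw
    simp only [Finset.mem_insert, Finset.mem_singleton] at hw
    rcases hw with rfl | rfl | rfl <;> assumption
  let I : X → X → Finset X := fun a b => S.filter fun w => B.rel a w b
  have hne : S.Nonempty := Finset.card_pos.1 (by omega)
  obtain ⟨⟨a, b⟩, hab, hmax⟩ := Finset.exists_max_image (S ×ˢ S) (fun p => (I p.1 p.2).card)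
    (hne.product hne)
  rw [Finset.mem_product] at hab
  obtain ⟨ha, hb⟩ := hab
  simp only at ha hb hmax
  have hnlt : ∀ c ∈ S, ∀ d ∈ S, c ∉ I a b → c ∈ I d c → I a b ⊆ I d c → False := by
    intro c hc d hd hcab hdc hsub
    have h1 := hmax (d, c) (Finset.mem_product.2 ⟨hd, hc⟩)
    have h2 := Finset.card_lt_card (Finset.ssubset_iff_of_subset hsub |>.2 ⟨c, hdc, hcab⟩)
    simp only at h1
    omega
  -- The pair `a, b` was chosen with the most points between its members. A point `c` outside this
  -- interval would be collinear beyond one of the ends, and the interval from the other end to `c`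
  -- would be larger.
  have hall : ∀ c ∈ S, B.rel a c b := by
    intro c hc
    by_contra hcab
    have hca : c ≠ a := by rintro rfl; exact hcab (hB.p1 _ _)
    have hcb : c ≠ b := by rintro rfl; exact hcab (hB.right _ _)
    have hcI : c ∉ I a b := by simp [I, hcab]
    have h : B.rel a b c ∨ B.rel b a c := by
      by_cases hab : a = b
      · subst hab; exact Or.inl (hB.p1 _ _)
      · rcases hcol a ha b hb c hc hab hcb.symm hca.symm with h | h | h
        · exact Or.inl h
        · exact Or.inr h
        · exact absurd h hcab
    rcases h with h | h
    · refine hnlt c hc a ha hcI (by simp [I, hc, hB.right]) fun w hw => ?_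
      simp only [I, Finset.mem_filter] at hw ⊢
      exact ⟨hw.1, (hB.p4 _ _ _ _ h hw.2).1⟩
    · refine hnlt c hc b hb hcI (by simp [I, hc, hB.right]) fun w hw => ?_
      simp only [I, Finset.mem_filter] at hw ⊢
      exact ⟨hw.1, (hB.p4 _ _ _ _ h (hB.p2 _ _ _ hw.2)).1⟩
  have hab : a ≠ b := by
    rintro rfl
    have : S ⊆ {a} := fun w hw => Finset.mem_singleton.2 (hB.eq_of_rel_self (hall w hw)).symm
    have := Finset.card_le_card this
    simp at this
    omega
  -- If `a` were between `x` and `y`, compare with the other end `b`. When `b` is not between `x`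
  -- and `y`, `a` falls between `b` and one of them, against `hall`. When it is, `a, x, b, y` form a
  -- square, which a fifth point excludes.
  have hnot : ∀ x ∈ S, ∀ y ∈ S, x ≠ a → y ≠ a → x ≠ y → ¬ B.rel x a y := by
    intro x hx y hy hxa hya hxy h
    have hxb : x ≠ b := by
      rintro rfl
      exact hB.not_rel_right hya.symm h (hB.p2 _ _ _ (hall y hy))
    have hyb : y ≠ b := by
      rintro rfl
      exact hB.not_rel_left hxa h (hall x hx)
    rcases hcol x hx y hy b hb hxy hyb hxb with h' | h' | h'
    · exact hB.not_rel_left hxa (hB.p4 _ _ _ _ h' h).1 (hall x hx)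
    · exact hB.not_rel_left hya (hB.p4 _ _ _ _ h' (hB.p2 _ _ _ h)).1 (hall y hy)
    · obtain ⟨e, he, heq⟩ := Finset.exists_mem_notMem_of_card_lt_card
        (s := {a, x, b, y}) (t := S) (lt_of_le_of_lt Finset.card_le_four (by omega))
      simp only [Finset.mem_insert, Finset.mem_singleton, not_or] at heq
      obtain ⟨hea, hex, heb, hey⟩ := heq
      refine hB.not_square (a := a) (b := x) (c := b) (d := y) (e := e) ?_ (fun T hT => hno T ?_)
        (hall x hx) h' (hB.p2 _ _ _ (hall y hy)) (hB.p2 _ _ _ h)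
      · simp [hxa.symm, hab, hya.symm, Ne.symm hea, hxb, hxy, Ne.symm hex, hyb.symm, Ne.symm heb,
          Ne.symm hey]
      · refine hT.trans fun w hw => ?_
        simp only [List.mem_toFinset, List.mem_cons, List.not_mem_nil, or_false] at hw
        rcases hw with rfl | rfl | rfl | rfl | rfl <;> assumption
  have htot : ∀ x ∈ S, ∀ y ∈ S, B.rel a x y ∨ B.rel a y x := by
    intro x hx y hy
    by_cases hxa : x = a
    · subst hxa; exact Or.inl (hB.p1 _ _)
    by_cases hya : y = a
    · subst hya; exact Or.inr (hB.p1 _ _)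
    by_cases hxy : x = y
    · subst hxy; exact Or.inl (hB.right _ _)
    rcases hcol x hx a ha y hy hxa (Ne.symm hya) hxy with h | h | h
    · exact absurd h (hnot x hx y hy hxa hya hxy)
    · exact Or.inl h
    · exact Or.inr (hB.p2 _ _ _ h)
  have hlt : ∀ x ∈ S, ∀ y ∈ S, x ≠ y → B.rel a x y → (I a x).card < (I a y).card := by
    intro x hx y hy hxy h
    refine Finset.card_lt_card ((Finset.ssubset_iff_of_subset fun w hw => ?_).2 ⟨y, ?_, ?_⟩)
    · simp only [I, Finset.mem_filter] at hw ⊢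
      exact ⟨hw.1, (hB.p4 _ _ _ _ h hw.2).1⟩
    · simp [I, hy, hB.right]
    · simp only [I, Finset.mem_filter, not_and]
      exact fun _ => hB.not_rel_right hxy h
  have hle : ∀ x ∈ S, ∀ y ∈ S, (I a x).card ≤ (I a y).card → B.rel a x y := by
    intro x hx y hy h
    by_cases hxy : x = y
    · subst hxy; exact hB.right _ _
    · rcases htot x hx y hy with h' | h'
      · exact h'
      · have := hlt y hy x hx (Ne.symm hxy) h'
        omega
  -- A point is ranked by the number of points between it and the end `a`.
  refine ⟨fun x => (I a x).card, fun x hx y hy hxy => ?_, fun x hx y hy z hz hxy hyz => ?_⟩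
  · by_contra hne
    simp only [Nat.cast_inj] at hxy
    have := hlt x hx y hy hne (hle x hx y hy hxy.le)
    omega
  · simp only [Nat.cast_le] at hxy hyz
    exact (hB.p4 _ _ _ _ (hle y hy z hz hyz) (hle x hx y hy hxy)).2

/-! ### The lower bound for the co-size and the points common to all triangles -/

open Classical in
/-- The triangles among the points of a finite set. -/
noncomputable def triangles (B : BetweennessStructure X) (S : Finset X) : Finset (Finset X) :=
  S.powerset.filter B.IsTriangle

theorem mem_triangles {S T : Finset X} : T ∈ B.triangles S ↔ T ⊆ S ∧ B.IsTriangle T := by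
  simp [triangles]

theorem coSize_eq_card [Fintype X] : B.coSize = (B.triangles Finset.univ).card := by
  rw [coSize, ← Set.ncard_coe_finset]
  congr 1
  ext T
  simp [mem_triangles]

theorem triangles_mono {S S' : Finset X} (h : S ⊆ S') : B.triangles S ⊆ B.triangles S' :=
  fun _ hT => mem_triangles.2 ⟨(mem_triangles.1 hT).1.trans h, (mem_triangles.1 hT).2⟩

/-- Deleting a point of one triangle while another survives lowers the order by one and the number
of triangles by at least one. If no such deletion exists, every triangle contains every point of
every other, so there is only one triangle, and any six points containing it contradict
`exists_second_triangle`. -/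
theorem AlmostMetrizable.card_le_of_triangle [DecidableEq X] (hB : B.AlmostMetrizable)
    (S : Finset X) (hS : 6 ≤ S.card) (hT : (B.triangles S).Nonempty) :
    S.card ≤ (B.triangles S).card + 4 := by
  obtain ⟨k, hk⟩ := Nat.exists_eq_add_of_le hS
  induction k generalizing S with
  | zero =>
    obtain ⟨T, hT⟩ := hT
    obtain ⟨hTS, hT'⟩ := mem_triangles.1 hT
    obtain ⟨T', hTS', hT'', hne⟩ := hB.exists_second_triangle hk hT' hTS
    have : 1 < (B.triangles S).card :=
      Finset.one_lt_card.2 ⟨T, hT, T', mem_triangles.2 ⟨hTS', hT''⟩, hne.symm⟩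
    omega
  | succ k ih =>
    by_cases h : ∃ T ∈ B.triangles S, ∃ x ∈ T, (B.triangles (S.erase x)).Nonempty
    · obtain ⟨T, hT, x, hx, hne⟩ := h
      have hxS := (mem_triangles.1 hT).1 hx
      have hcard := Finset.card_erase_of_mem hxS
      have h1 := ih (S.erase x) (by omega) hne (by omega)
      have h2 : (B.triangles (S.erase x)).card < (B.triangles S).card := by
        refine Finset.card_lt_card ((Finset.ssubset_iff_of_subset
          (triangles_mono (Finset.erase_subset _ _))).2 ⟨T, hT, fun h => ?_⟩)
        exact Finset.notMem_erase x S ((mem_triangles.1 h).1 hx)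
      omega
    · exfalso
      push Not at h
      obtain ⟨T, hT⟩ := hT
      obtain ⟨hTS, hT'⟩ := mem_triangles.1 hT
      obtain ⟨S', hTS', hSS', hS'⟩ := Finset.exists_subsuperset_card_eq (n := 6) hTS
        (by rw [hT'.1]; norm_num) (by omega)
      obtain ⟨T', hTS'', hT'', hne⟩ := hB.exists_second_triangle hS' hT' hTS'
      refine hne (Finset.eq_of_subset_of_card_le (fun x hx => ?_) (by rw [hT'.1, hT''.1])).symm
      by_contra hxT
      have hmem : T' ∈ B.triangles (S.erase x) := mem_triangles.2 ⟨fun y hy => Finset.mem_erase.2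
        ⟨fun h => hxT (h ▸ hy), hSS' (hTS'' hy)⟩, hT''⟩
      rw [h T hT x hx] at hmem
      exact Finset.notMem_empty _ hmem

/-- If all triangles contain `y` and `z`, they correspond to the points not collinear with
`y` and `z`. -/
theorem AlmostMetrizable.coSize_add_card [Fintype X] [DecidableEq X] (hB : B.AlmostMetrizable)
    {y z : X} (hyz : y ≠ z) (h : ∀ T, B.IsTriangle T → y ∈ T ∧ z ∈ T) (N : Finset X)
    (hN : ∀ w, w ∈ N ↔ w ≠ y ∧ w ≠ z ∧ B.Col y z w) :
    B.coSize + N.card + 2 = Fintype.card X := by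
  have hcard : (((Finset.univ.erase y).erase z) \ N).card = B.coSize := by
    rw [coSize_eq_card]
    refine Finset.card_bij (fun w _ => {y, z, w}) (fun w hw => ?_) (fun w hw w' hw' he => ?_)
      (fun T hT => ?_)
    · simp only [Finset.mem_sdiff, Finset.mem_erase, Finset.mem_univ, and_true, hN, not_and] at hw
      exact mem_triangles.2 ⟨Finset.subset_univ _, (hB.isTriangle_triple hyz hw.1.1.symm
        hw.1.2.symm).2 (hw.2 hw.1.2 hw.1.1)⟩
    · simp only [Finset.mem_sdiff, Finset.mem_erase, Finset.mem_univ, and_true] at hw hw'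
      have : w ∈ ({y, z, w'} : Finset X) := by rw [← he]; simp
      simp only [Finset.mem_insert, Finset.mem_singleton] at this
      exact (this.resolve_left hw.1.2).resolve_left hw.1.1
    · have hT' := (mem_triangles.1 hT).2
      obtain ⟨hy, hz⟩ := h T hT'
      obtain ⟨w, hwy, hwz, rfl⟩ := hT'.exists_third hyz hy hz
      refine ⟨w, ?_, rfl⟩
      simp only [Finset.mem_sdiff, Finset.mem_erase, Finset.mem_univ, and_true, hN, not_and]
      exact ⟨⟨hwz, hwy⟩, fun _ _ => (hB.isTriangle_triple hyz hwz.symm hwy.symm).1 hT'⟩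
  have hNsub : N ⊆ (Finset.univ.erase y).erase z := by
    intro w hw
    have := (hN w).1 hw
    simp [this.1, this.2.1]
  have h1 := Finset.card_sdiff_add_card_eq_card hNsub
  have h2 : z ∈ Finset.univ.erase y := by simp [hyz.symm]
  have h3 := Finset.card_erase_add_one h2
  have h4 := Finset.card_erase_add_one (Finset.mem_univ y)
  rw [Finset.card_univ] at h4
  omega

/-- In a structure of order at least seven and minimum positive co-size, all triangles share two
points. -/
theorem AlmostMetrizable.exists_pair_of_seven_le [Fintype X] [DecidableEq X]
    (hB : B.AlmostMetrizable) (hX : 7 ≤ Fintype.card X) (hco : B.coSize + 4 = Fintype.card X) :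
    ∃ y z, y ≠ z ∧ ∀ T, B.IsTriangle T → y ∈ T ∧ z ∈ T := by
  rw [coSize_eq_card] at hco
  set 𝒯 := B.triangles Finset.univ with h𝒯
  have hmem : ∀ {T}, T ∈ 𝒯 ↔ B.IsTriangle T := by simp [h𝒯, mem_triangles]
  -- If `T''` avoids `x`, deleting `x` keeps a triangle and removes at least two. At most `n - 6`
  -- are then left on `n - 1 ≥ 6` points, fewer than the `n - 5` that the bound requires.
  have hsplit : ∀ T ∈ 𝒯, ∀ T' ∈ 𝒯, T ≠ T' → ∀ x ∈ T, x ∈ T' → ∀ T'' ∈ 𝒯, x ∈ T'' := by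
    intro T hT T' hT' hne x hx hx' T'' hT''
    by_contra hx''
    have hsub : B.triangles (Finset.univ.erase x) ⊆ (𝒯.erase T).erase T' := by
      intro U hU
      have hxU : x ∉ U := fun h => Finset.notMem_erase x _ ((mem_triangles.1 hU).1 h)
      refine Finset.mem_erase.2 ⟨fun h => hxU (h ▸ hx'), Finset.mem_erase.2
        ⟨fun h => hxU (h ▸ hx), hmem.2 (mem_triangles.1 hU).2⟩⟩
    have h1 := Finset.card_le_card hsub
    rw [Finset.card_erase_of_mem (Finset.mem_erase.2 ⟨hne.symm, hT'⟩),
      Finset.card_erase_of_mem hT] at h1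
    have h2 := Finset.card_erase_of_mem (Finset.mem_univ x)
    rw [Finset.card_univ] at h2
    have h3 := hB.card_le_of_triangle (Finset.univ.erase x) (by omega)
      ⟨T'', mem_triangles.2 ⟨fun y hy => Finset.mem_erase.2
        ⟨fun h => hx'' (h ▸ hy), Finset.mem_univ _⟩, hmem.1 hT''⟩⟩
    omega
  let K : Finset X := Finset.univ.filter fun x => ∀ T ∈ 𝒯, x ∈ T
  have hK : ∀ {x}, x ∈ K ↔ ∀ T ∈ 𝒯, x ∈ T := by simp [K]
  have hKT : ∀ T ∈ 𝒯, K ⊆ T := fun T hT x hx => hK.1 hx T hT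
  have hdis : ∀ T ∈ 𝒯, ∀ T' ∈ 𝒯, T ≠ T' → Disjoint (T \ K) (T' \ K) := by
    intro T hT T' hT' hne
    rw [Finset.disjoint_left]
    intro x hx hx'
    rw [Finset.mem_sdiff] at hx hx'
    exact hx.2 (hK.2 (hsplit T hT T' hT' hne x hx.1 hx'.1))
  -- The triangles form a sunflower with core `K`, so their petals are disjoint subsets of the
  -- complement of `K`.
  have hcount : 𝒯.card * (3 - K.card) ≤ Fintype.card X - K.card := by
    have h1 : (𝒯.biUnion fun T => T \ K).card = 𝒯.card * (3 - K.card) := by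
      rw [Finset.card_biUnion hdis, Finset.sum_const_nat]
      intro T hT
      rw [Finset.card_sdiff_of_subset (hKT T hT), (hmem.1 hT).1]
    have h2 : 𝒯.biUnion (fun T => T \ K) ⊆ Finset.univ \ K := by
      intro x hx
      obtain ⟨T, -, hx⟩ := Finset.mem_biUnion.1 hx
      exact Finset.mem_sdiff.2 ⟨Finset.mem_univ _, (Finset.mem_sdiff.1 hx).2⟩
    have h3 := Finset.card_le_card h2
    rwa [h1, Finset.card_sdiff_of_subset (Finset.subset_univ _), Finset.card_univ] at h3
  by_cases hK2 : 1 < K.card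
  · obtain ⟨y, hy, z, hz, hyz⟩ := Finset.one_lt_card.1 hK2
    exact ⟨y, z, hyz, fun T hT => ⟨hK.1 hy T (hmem.2 hT), hK.1 hz T (hmem.2 hT)⟩⟩
  exfalso
  -- With `n - 4` triangles, an empty core gives `3 (n - 4) ≤ n`, impossible for `n ≥ 7`; a
  -- one-point core gives `2 (n - 4) ≤ n - 1`, so `n = 7`.
  have hK1 : K.card = 1 ∧ Fintype.card X = 7 := by
    obtain hk | hk : K.card = 0 ∨ K.card = 1 := by omega
    · rw [hk] at hcount
      omega
    · rw [hk] at hcount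
      omega
  obtain ⟨v, hv⟩ := Finset.card_eq_one.1 hK1.1
  obtain ⟨T₁, T₂, T₃, hne₁₂, hne₁₃, hne₂₃, h3⟩ := Finset.card_eq_three.1
    (show 𝒯.card = 3 by omega)
  have h₁ : T₁ ∈ 𝒯 := by simp [h3]
  have h₂ : T₂ ∈ 𝒯 := by simp [h3]
  have h₃ : T₃ ∈ 𝒯 := by simp [h3]
  -- Deleting a petal point of `T₃` leaves six points whose only triangles are `T₁` and `T₂`, which
  -- share just `v`.
  obtain ⟨x, hx, hxv⟩ := Finset.exists_mem_notMem_of_card_lt_card (s := K) (t := T₃)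
    (by rw [hK1.1, (hmem.1 h₃).1]; norm_num)
  have hx₁ : x ∉ T₁ := fun h => hxv (hK.2 (hsplit _ h₁ _ h₃ hne₁₃ x h hx))
  have hx₂ : x ∉ T₂ := fun h => hxv (hK.2 (hsplit _ h₂ _ h₃ hne₂₃ x h hx))
  have hsub : ∀ {T : Finset X}, x ∉ T → T ⊆ Finset.univ.erase x := fun hxT y hy =>
    Finset.mem_erase.2 ⟨fun h => hxT (h ▸ hy), Finset.mem_univ _⟩
  have hinter : T₁ ∩ T₂ = {v} := by
    rw [← hv]
    ext y
    rw [Finset.mem_inter]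
    exact ⟨fun h => hK.2 (hsplit _ h₁ _ h₂ hne₁₂ y h.1 h.2), fun h => ⟨hKT _ h₁ h, hKT _ h₂ h⟩⟩
  obtain ⟨T, hT, hT', hne, hne'⟩ := hB.exists_third_triangle (S := Finset.univ.erase x)
    (by rw [Finset.card_erase_of_mem (Finset.mem_univ x), Finset.card_univ]; omega)
    (hmem.1 h₁) (hsub hx₁) (hmem.1 h₂) (hsub hx₂) hinter
  have hT3 := hmem.2 hT'
  rw [h3] at hT3
  simp only [Finset.mem_insert, Finset.mem_singleton, hne, hne', false_or] at hT3
  subst hT3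
  exact Finset.notMem_erase x _ (hT hx)

/-- In a structure of order six and co-size two, the triangles are disjoint or share two points. -/
theorem AlmostMetrizable.exists_pair_or_isoTable [Fintype X] [DecidableEq X]
    (hB : B.AlmostMetrizable) (hX : Fintype.card X = 6) (hco : B.coSize = 2) :
    (∃ y z, y ≠ z ∧ ∀ T, B.IsTriangle T → y ∈ T ∧ z ∈ T) ∨ B.IsoTable 6 Search.tablesSix := by
  rw [coSize_eq_card] at hco
  obtain ⟨T₁, T₂, hne, h2⟩ := Finset.card_eq_two.1 hco
  have hmem : ∀ {T}, B.IsTriangle T ↔ T = T₁ ∨ T = T₂ := by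
    intro T
    have : T ∈ B.triangles Finset.univ ↔ B.IsTriangle T := by simp [mem_triangles]
    rw [← this, h2]
    simp
  have h₁ : B.IsTriangle T₁ := hmem.2 (Or.inl rfl)
  have h₂ : B.IsTriangle T₂ := hmem.2 (Or.inr rfl)
  by_cases hc : 1 < (T₁ ∩ T₂).card
  · obtain ⟨y, hy, z, hz, hyz⟩ := Finset.one_lt_card.1 hc
    rw [Finset.mem_inter] at hy hz
    refine Or.inl ⟨y, z, hyz, fun T hT => ?_⟩
    rcases hmem.1 hT with rfl | rfl
    · exact ⟨hy.1, hz.1⟩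
    · exact ⟨hy.2, hz.2⟩
  · right
    obtain hk | hk : (T₁ ∩ T₂).card = 0 ∨ (T₁ ∩ T₂).card = 1 := by omega
    · rw [Finset.card_eq_zero, ← Finset.disjoint_iff_inter_eq_empty] at hk
      exact hB.isoTable_of_disjoint h₁ h₂ hk (fun T hT => hmem.1 hT)
        (by rw [Nat.card_eq_fintype_card, hX])
    · obtain ⟨v, hv⟩ := Finset.card_eq_one.1 hk
      obtain ⟨T, -, hT, hT₁, hT₂⟩ := hB.exists_third_triangle (S := Finset.univ)
        (by rw [Finset.card_univ, hX]) h₁ (Finset.subset_univ _) h₂ (Finset.subset_univ _) hv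
      exact absurd (hmem.1 hT) (by simp [hT₁, hT₂])

end BetweennessStructure

/-! ### Certificates for shortest-path metrics -/

namespace WeightedGraph

open BetweennessStructure

variable {V : Type*}

/-- A certificate that `f` is the metric of a weighted graph with natural weights: it is
`1`-Lipschitz along edges, and from `u ≠ v` there is an edge that leads closer to `v`. -/
structure IsNatDist (W : WeightedGraph V) (wt f : V → V → ℕ) : Prop where
  weight_eq : ∀ u v, W.graph.Adj u v → W.weight u v = wt u v
  self : ∀ u, f u u = 0
  le_step : ∀ u v w, W.graph.Adj v w → f u w ≤ f u v + wt v w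
  exists_step : ∀ u v, u ≠ v → ∃ w, W.graph.Adj u w ∧ f u v = wt u w + f w v

namespace IsNatDist

variable {W : WeightedGraph V} {wt f : V → V → ℕ}

theorem le_walkLength (h : W.IsNatDist wt f) (u : V) {v w : V} (p : W.graph.Walk v w) :
    (f u w : ℝ) ≤ f u v + W.walkLength p := by
  induction p with
  | nil => simp [walkLength]
  | @cons a b c hab p ih =>
    have h1 : W.walkLength (.cons hab p) = W.weight a b + W.walkLength p := by
      simp [walkLength]
    have h2 : (f u b : ℝ) ≤ f u a + wt a b := by exact_mod_cast h.le_step u a b hab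
    rw [h1, h.weight_eq a b hab]
    linarith

theorem wt_pos (h : W.IsNatDist wt f) {u v : V} (huv : W.graph.Adj u v) : 0 < wt u v := by
  have := W.weight_pos u v huv
  rw [h.weight_eq u v huv] at this
  exact_mod_cast this

/-- Follow the edges that lead closer to `v`; the value of `f` drops each time because the weights
are positive. -/
theorem exists_walk (h : W.IsNatDist wt f) (u v : V) :
    ∃ p : W.graph.Walk u v, W.walkLength p = f u v := by
  obtain ⟨k, hk⟩ : ∃ k, f u v = k := ⟨_, rfl⟩
  induction k using Nat.strong_induction_on generalizing u with
  | _ k ih =>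
    by_cases huv : u = v
    · subst huv
      exact ⟨.nil, by simp [walkLength, h.self]⟩
    · obtain ⟨w, hw, hf⟩ := h.exists_step u v huv
      have := h.wt_pos hw
      obtain ⟨p, hp⟩ := ih (f w v) (by omega) w rfl
      refine ⟨.cons hw p, ?_⟩
      have h1 : W.walkLength (.cons hw p) = W.weight u w + W.walkLength p := by
        simp [walkLength]
      rw [h1, hp, hf, h.weight_eq u w hw]
      push_cast
      rfl

theorem dist_eq (h : W.IsNatDist wt f) (u v : V) : W.dist u v = f u v := by
  obtain ⟨p, hp⟩ := h.exists_walk u v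
  have hle : ∀ q : W.graph.Walk u v, (f u v : ℝ) ≤ W.walkLength q := by
    intro q
    simpa [h.self] using h.le_walkLength u q
  have : Nonempty (W.graph.Walk u v) := ⟨p⟩
  refine le_antisymm ?_ (le_ciInf hle)
  rw [← hp]
  exact ciInf_le ⟨(f u v : ℝ), by rintro _ ⟨q, rfl⟩; exact hle q⟩ p

theorem rel_iff (h : W.IsNatDist wt f) (x y z : V) :
    W.betweenness.rel x y z ↔ f x z = f x y + f y z := by
  simp only [betweenness, h.dist_eq]
  norm_cast

theorem triangle (h : W.IsNatDist wt f) (u v w : V) : f u w ≤ f u v + f v w := by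
  obtain ⟨p, hp⟩ := h.exists_walk v w
  have := h.le_walkLength u p
  rw [hp] at this
  exact_mod_cast this

theorem walkLength_reverse {u v : V} (p : W.graph.Walk u v) :
    W.walkLength p.reverse = W.walkLength p := by
  simp only [walkLength, SimpleGraph.Walk.darts_reverse, List.map_reverse, List.sum_reverse,
    List.map_map]
  congr 1
  refine List.map_congr_left fun d _ => ?_
  simp [W.weight_symm d.snd d.fst]

theorem symm (h : W.IsNatDist wt f) (u v : V) : f u v = f v u := by
  have key : ∀ u v, f u v ≤ f v u := by
    intro u v
    obtain ⟨p, hp⟩ := h.exists_walk v u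
    have := h.le_walkLength u p.reverse
    rw [walkLength_reverse, hp, h.self] at this
    simpa using this
  exact le_antisymm (key u v) (key v u)

theorem eq_of_eq_zero (h : W.IsNatDist wt f) {u v : V} (huv : f u v = 0) : u = v := by
  by_contra hne
  obtain ⟨w, hw, hf⟩ := h.exists_step u v hne
  have := h.wt_pos hw
  omega

theorem almostMetrizable (h : W.IsNatDist wt f) : W.betweenness.AlmostMetrizable := by
  refine ⟨fun x z => ?_, fun x y z => ?_, fun x y z => ?_, fun x y z w => ?_⟩ <;>
    simp only [h.rel_iff]
  · rw [h.self, zero_add]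
  · rw [h.symm z x, h.symm z y, h.symm y x]
    omega
  · intro h1 h2
    refine h.eq_of_eq_zero ?_
    have := h.symm x y
    omega
  · intro h1 h2
    have h3 := h.triangle x w z
    have h4 := h.triangle w y z
    omega

/-- Expresses the co-size as a count over a decidable condition, which the kernel can evaluate for
the small graphs. -/
theorem coSize_eq [Fintype V] [DecidableEq V] (h : W.IsNatDist wt f) :
    W.betweenness.coSize = ((Finset.univ.powersetCard 3).filter fun T : Finset V =>
      ∀ x ∈ T, ∀ y ∈ T, ∀ z ∈ T, x ≠ y → y ≠ z → x ≠ z → f x z ≠ f x y + f y z).card := by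
  rw [coSize, ← Set.ncard_coe_finset]
  congr 1
  ext T
  simp [IsTriangle, h.rel_iff, Finset.mem_powersetCard]

end IsNatDist

theorem isNatDist_ofSimple {G : SimpleGraph V} {f : V → V → ℕ} (h0 : ∀ u, f u u = 0)
    (h1 : ∀ u v w, G.Adj v w → f u w ≤ f u v + 1)
    (h2 : ∀ u v, u ≠ v → ∃ w, G.Adj u w ∧ f u v = 1 + f w v) :
    (ofSimple G).IsNatDist (fun _ _ => 1) f where
  weight_eq _ _ _ := by simp [ofSimple]
  self := h0
  le_step := h1
  exists_step := h2

/-! ### The eight exceptional graphs -/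

section Small

open Search

theorem isNatDist_K3 : (ofSimple (⊤ : SimpleGraph (Fin 3))).IsNatDist (fun _ _ => 1)
    (fun u v => distK3 u v) :=
  isNatDist_ofSimple (by decide) (by decide) (by decide)

theorem isNatDist_K13 : (ofSimple (completeBipartiteGraph (Fin 1) (Fin 3))).IsNatDist
    (fun _ _ => 1) (fun u v => distK13 (finSumFinEquiv u) (finSumFinEquiv v)) := by
  refine isNatDist_ofSimple (by decide) ?_ ?_ <;> simp only [completeBipartiteGraph_adj] <;>
    decide +kernel

theorem isNatDist_weightedC4 : weightedC4.IsNatDist (fun u v => if u = 3 ∨ v = 3 then 2 else 1)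
    (fun u v => distC4 u v) where
  weight_eq u v _ := by
    simp only [weightedC4]
    split_ifs <;> norm_num
  self := by decide
  le_step := by unfold weightedC4; decide
  exists_step := by unfold weightedC4; decide

theorem isNatDist_K23 : (ofSimple (completeBipartiteGraph (Fin 2) (Fin 3))).IsNatDist
    (fun _ _ => 1) (fun u v => distK23 (finSumFinEquiv u) (finSumFinEquiv v)) := by
  refine isNatDist_ofSimple (by decide) ?_ ?_ <;> simp only [completeBipartiteGraph_adj] <;>
    decide +kernel

theorem isNatDist_C6 : (ofSimple (SimpleGraph.cycleGraph 6)).IsNatDist (fun _ _ => 1)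
    (fun u v => distC6 u v) :=
  isNatDist_ofSimple (by decide) (by decide +kernel) (by decide +kernel)

theorem isNatDist_C6OneDiagonal :
    (ofSimple (SimpleGraph.cycleGraph 6 ⊔ SimpleGraph.edge 0 3)).IsNatDist (fun _ _ => 1)
    (fun u v => distC6OneDiagonal u v) := by
  refine isNatDist_ofSimple (by decide) ?_ ?_ <;>
    simp only [SimpleGraph.sup_adj, SimpleGraph.edge_adj] <;> decide +kernel

theorem isNatDist_C6TwoDiagonals :
    (ofSimple (SimpleGraph.cycleGraph 6 ⊔ SimpleGraph.edge 0 3 ⊔ SimpleGraph.edge 1 4)).IsNatDist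
    (fun _ _ => 1) (fun u v => distC6TwoDiagonals u v) := by
  refine isNatDist_ofSimple (by decide) ?_ ?_ <;>
    simp only [SimpleGraph.sup_adj, SimpleGraph.edge_adj] <;> decide +kernel

/-- The vertices of `K_{3,3}` in the order of a Hamiltonian cycle. -/
noncomputable def cyclicEquiv : Fin 3 ⊕ Fin 3 ≃ Fin 6 :=
  Equiv.ofBijective (Sum.elim ![0, 2, 4] ![1, 3, 5]) (by decide)

theorem isNatDist_K33 : (ofSimple (completeBipartiteGraph (Fin 3) (Fin 3))).IsNatDist
    (fun _ _ => 1) (fun u v => distK33 (cyclicEquiv u) (cyclicEquiv v)) := by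
  simp only [cyclicEquiv, Equiv.ofBijective_apply]
  refine isNatDist_ofSimple (by decide) ?_ ?_ <;> simp only [completeBipartiteGraph_adj] <;>
    decide +kernel

theorem coSize_K3 : (ofSimple (⊤ : SimpleGraph (Fin 3))).betweenness.coSize = 1 := by
  rw [isNatDist_K3.coSize_eq]; decide +kernel

theorem coSize_K13 :
    (ofSimple (completeBipartiteGraph (Fin 1) (Fin 3))).betweenness.coSize = 1 := by
  rw [isNatDist_K13.coSize_eq]; decide +kernel

theorem coSize_weightedC4 : weightedC4.betweenness.coSize = 1 := by
  rw [isNatDist_weightedC4.coSize_eq]; decide +kernel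

theorem coSize_K23 :
    (ofSimple (completeBipartiteGraph (Fin 2) (Fin 3))).betweenness.coSize = 1 := by
  rw [isNatDist_K23.coSize_eq]; decide +kernel

theorem coSize_C6 : (ofSimple (SimpleGraph.cycleGraph 6)).betweenness.coSize = 2 := by
  rw [isNatDist_C6.coSize_eq]; decide +kernel

theorem coSize_C6OneDiagonal :
    (ofSimple (SimpleGraph.cycleGraph 6 ⊔ SimpleGraph.edge 0 3)).betweenness.coSize = 2 := by
  rw [isNatDist_C6OneDiagonal.coSize_eq]; decide +kernel

theorem coSize_C6TwoDiagonals : (ofSimple (SimpleGraph.cycleGraph 6 ⊔ SimpleGraph.edge 0 3 ⊔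
    SimpleGraph.edge 1 4)).betweenness.coSize = 2 := by
  rw [isNatDist_C6TwoDiagonals.coSize_eq]; decide +kernel

theorem coSize_K33 :
    (ofSimple (completeBipartiteGraph (Fin 3) (Fin 3))).betweenness.coSize = 2 := by
  rw [isNatDist_K33.coSize_eq]
  simp only [cyclicEquiv, Equiv.ofBijective_apply]
  decide +kernel

end Small

/-! ### Metric and co-size of the two infinite families -/

/-- The vertices of `R⁴_{n,i}` and `S⁴_n` other than `y` and `z` are numbered. -/
def vertexEquiv (m : ℕ) : Vertex m ≃ Option (Option (Fin m)) where
  toFun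
    | .x j => some (some j)
    | .y => some none
    | .z => none
  invFun
    | some (some j) => .x j
    | some none => .y
    | none => .z
  left_inv u := by cases u <;> rfl
  right_inv u := by rcases u with _ | _ | _ <;> rfl

noncomputable instance (m : ℕ) : DecidableEq (Vertex m) := Classical.decEq _

noncomputable instance (m : ℕ) : Fintype (Vertex m) := Fintype.ofEquiv _ (vertexEquiv m).symm

theorem card_vertex (m : ℕ) : Fintype.card (Vertex m) = m + 2 := by
  rw [Fintype.card_congr (vertexEquiv m)]
  simp

/-- The metric in which points are at the distance of their positions on a line, except that the
distance between `y` and `z` is `c`. -/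
def lineDist {m : ℕ} (pos : Vertex m → ℕ) (c : ℕ) : Vertex m → Vertex m → ℕ
  | .y, .z => c
  | .z, .y => c
  | u, v => (pos u - pos v) + (pos v - pos u)

/-- The position of a vertex of `R⁴_{n,i}`. -/
def r4Pos (m i : ℕ) : Vertex m → ℕ
  | .x j => if j.val < i then j.val else j.val + 1
  | _ => i

/-- The position of a vertex of `S⁴_n`. -/
def s4Pos (m : ℕ) : Vertex m → ℕ
  | .x j => j.val + 1
  | .y => 0
  | .z => m + 1

/-- Both `y` and `z` fill the gap between `x_i` and `x_{i+1}`, at distance two from each other; all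
other distances are those of positions on a line. The bound `i + 3 ≤ n` says that `x_{i+1}` exists.
-/
theorem isNatDist_r4 {n i : ℕ} (hi : 1 ≤ i) (hin : i + 3 ≤ n) :
    (r4 n i).IsNatDist (fun _ _ => 1) (lineDist (r4Pos (n - 2) i) 2) := by
  refine isNatDist_ofSimple (fun u => ?_) (fun u v w h => ?_) (fun u v huv => ?_)
  · cases u <;> simp [lineDist]
  · rw [SimpleGraph.fromRel_adj] at h
    obtain ⟨-, h⟩ := h
    rcases u with u | _ | _ <;> rcases v with v | _ | _ <;> rcases w with w | _ | _ <;>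
      simp only [r4Rel, or_false, false_or, or_self] at h <;>
      simp only [lineDist, r4Pos] <;> (try split_ifs) <;> omega
  · have hadj : ∀ u v, u ≠ v → r4Rel n i u v ∨ r4Rel n i v u →
        (SimpleGraph.fromRel (r4Rel n i)).Adj u v := fun u v h h' =>
      (SimpleGraph.fromRel_adj _ _ _).2 ⟨h, h'⟩
    rcases u with u | _ | _
    · by_cases hlt : r4Pos (n - 2) i (.x u) < r4Pos (n - 2) i v
      -- Here `u` is `x_i`, whose right neighbours are `y` and `z`. The step goes through `y` unless
      -- the target is `z` itself.
      · by_cases hu : u.val + 1 = i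
        · rcases v with v | _ | _
          · refine ⟨.y, hadj _ _ (by simp) (by simp [r4Rel, hu]), ?_⟩
            simp only [lineDist, r4Pos] at hlt ⊢
            split_ifs at hlt ⊢ <;> omega
          · refine ⟨.y, hadj _ _ (by simp) (by simp [r4Rel, hu]), ?_⟩
            simp only [lineDist, r4Pos] at hlt ⊢
            split_ifs at hlt ⊢ <;> omega
          · refine ⟨.z, hadj _ _ (by simp) (by simp [r4Rel, hu]), ?_⟩
            simp only [lineDist, r4Pos] at hlt ⊢
            split_ifs at hlt ⊢ <;> omega
        · have hu' : u.val + 1 < n - 2 := by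
            rcases v with v | _ | _ <;> simp only [r4Pos] at hlt <;> split_ifs at hlt <;> omega
          refine ⟨.x ⟨u.val + 1, hu'⟩, hadj _ _ (by simp [Fin.ext_iff]) (by simp [r4Rel, hu]), ?_⟩
          rcases v with v | _ | _ <;> simp only [lineDist, r4Pos] at hlt ⊢ <;>
            split_ifs at hlt ⊢ <;> omega
      · by_cases hu : u.val = i
        · rcases v with v | _ | _
          · refine ⟨.y, hadj _ _ (by simp) (by simp [r4Rel, hu]), ?_⟩
            have huv' : u.val ≠ v.val := fun h => huv (by rw [Fin.ext h])
            simp only [lineDist, r4Pos] at hlt ⊢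
            split_ifs at hlt ⊢ <;> omega
          · refine ⟨.y, hadj _ _ (by simp) (by simp [r4Rel, hu]), ?_⟩
            simp only [lineDist, r4Pos] at hlt ⊢
            split_ifs at hlt ⊢ <;> omega
          · refine ⟨.z, hadj _ _ (by simp) (by simp [r4Rel, hu]), ?_⟩
            simp only [lineDist, r4Pos] at hlt ⊢
            split_ifs at hlt ⊢ <;> omega
        · have hu' : 0 < u.val ∧ ∀ v', v = .x v' → u.val ≠ v'.val := by
            refine ⟨?_, fun v' hv h => huv (by rw [hv, Fin.ext h])⟩
            rcases v with v | _ | _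
            · have huv' : u.val ≠ v.val := fun h => huv (by rw [Fin.ext h])
              simp only [r4Pos] at hlt
              split_ifs at hlt <;> omega
            all_goals
              simp only [r4Pos] at hlt
              split_ifs at hlt <;> omega
          have hlt' : u.val - 1 < n - 2 := by omega
          refine ⟨.x ⟨u.val - 1, hlt'⟩, hadj _ _ ?_ (Or.inr ?_), ?_⟩
          · simp only [ne_eq, Vertex.x.injEq, Fin.ext_iff]
            omega
          · simp only [r4Rel]
            omega
          rcases v with v | _ | _
          · have := hu'.2 v rfl
            simp only [lineDist, r4Pos] at hlt ⊢
            split_ifs at hlt ⊢ <;> omega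
          all_goals
            simp only [lineDist, r4Pos] at hlt ⊢
            split_ifs at hlt ⊢ <;> omega
    all_goals
      -- From `y` or `z` step right if the target lies to the right. Otherwise step left; this also
      -- covers the case that the target is the other one of `y` and `z`.
      by_cases hv : ∃ v', v = .x v' ∧ i ≤ v'.val
      · obtain ⟨v', rfl, hv⟩ := hv
        refine ⟨.x ⟨i, by omega⟩, hadj _ _ (by simp) (by simp [r4Rel]), ?_⟩
        simp only [lineDist, r4Pos]
        split_ifs <;> omega
      · push Not at hv
        refine ⟨.x ⟨i - 1, by omega⟩, hadj _ _ (by simp)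
          (Or.inl (Or.inl (by simp only; omega))), ?_⟩
        rcases v with v | _ | _
        · have := hv v rfl
          simp only [lineDist, r4Pos]
          split_ifs <;> omega
        all_goals
          first
          | exact absurd rfl huv
          | simp only [lineDist, r4Pos]
            split_ifs <;> omega

/-- The graph is a cycle of total length `2 (n - 2)`. Along the path from `y` to `z`, every pair
except `y, z` is at most `n - 2` apart, half the cycle, so only that pair gains from the heavy edge.
-/
theorem isNatDist_s4 {n : ℕ} (hn : 5 ≤ n) :
    (s4 n hn).IsNatDist (fun u v => match u, v with
        | .y, .z => n - 3
        | .z, .y => n - 3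
        | _, _ => 1) (lineDist (s4Pos (n - 2)) (n - 3)) where
  weight_eq u v _ := by
    have h : ((n - 3 : ℕ) : ℝ) = n - 3 := by rw [Nat.cast_sub (by omega)]; norm_num
    rcases u with u | _ | _ <;> rcases v with v | _ | _ <;> simp [s4, s4Weight, h]
  self u := by cases u <;> simp [lineDist]
  le_step u v w h := by
    simp only [s4, SimpleGraph.fromRel_adj] at h
    obtain ⟨-, h⟩ := h
    rcases u with u | _ | _ <;> rcases v with v | _ | _ <;> rcases w with w | _ | _ <;>
      simp only [s4Rel, or_false, false_or, or_self, or_true] at h <;>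
      simp only [lineDist, s4Pos] <;> omega
  exists_step u v huv := by
    have hadj : ∀ u v, u ≠ v → s4Rel n u v ∨ s4Rel n v u → (s4 n hn).graph.Adj u v :=
      fun u v h h' => (SimpleGraph.fromRel_adj _ _ _).2 ⟨h, h'⟩
    rcases u with u | _ | _
    · by_cases hlt : s4Pos (n - 2) (.x u) < s4Pos (n - 2) v
      · by_cases hu : u.val + 1 = n - 2
        · refine ⟨.z, hadj _ _ (by simp) (by simp [s4Rel, hu]), ?_⟩
          rcases v with v | _ | _ <;> simp only [lineDist, s4Pos] at hlt ⊢ <;> omega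
        · refine ⟨.x ⟨u.val + 1, by omega⟩, hadj _ _ (by simp [Fin.ext_iff]) (by simp [s4Rel]), ?_⟩
          rcases v with v | _ | _ <;> simp only [lineDist, s4Pos] at hlt ⊢ <;> omega
      · by_cases hu : u.val = 0
        · refine ⟨.y, hadj _ _ (by simp) (by simp [s4Rel, hu]), ?_⟩
          rcases v with v | _ | _
          · have huv' : u.val ≠ v.val := fun h => huv (by rw [Fin.ext h])
            simp only [lineDist, s4Pos] at hlt ⊢
            omega
          all_goals
            simp only [lineDist, s4Pos] at hlt ⊢
            omega
        · have hlt' : u.val - 1 < n - 2 := by omega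
          refine ⟨.x ⟨u.val - 1, hlt'⟩, hadj _ _ ?_ (Or.inr ?_), ?_⟩
          · simp only [ne_eq, Vertex.x.injEq, Fin.ext_iff]
            omega
          · simp only [s4Rel]
            omega
          rcases v with v | _ | _
          · have huv' : u.val ≠ v.val := fun h => huv (by rw [Fin.ext h])
            simp only [lineDist, s4Pos] at hlt ⊢
            omega
          all_goals
            simp only [lineDist, s4Pos] at hlt ⊢
            omega
    · rcases v with v | _ | _
      · refine ⟨.x ⟨0, by omega⟩, hadj _ _ (by simp) (by simp [s4Rel]), ?_⟩
        simp only [lineDist, s4Pos]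
        omega
      · exact absurd rfl huv
      · exact ⟨.z, hadj _ _ (by simp) (by simp [s4Rel]), by simp [lineDist]⟩
    · rcases v with v | _ | _
      · refine ⟨.x ⟨n - 3, by omega⟩, hadj _ _ (by simp) (Or.inr (by simp only [s4Rel]; omega)), ?_⟩
        simp only [lineDist, s4Pos]
        omega
      · exact ⟨.y, hadj _ _ (by simp) (by simp [s4Rel]), by simp [lineDist]⟩
      · exact absurd rfl huv

theorem lineDist_eq {m : ℕ} (pos : Vertex m → ℕ) (c : ℕ) {a b : Vertex m}
    (hab : (a ≠ .y ∧ b ≠ .y) ∨ (a ≠ .z ∧ b ≠ .z)) :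
    lineDist pos c a b = (pos a - pos b) + (pos b - pos a) := by
  rcases a with a | _ | _ <;> rcases b with b | _ | _ <;> first | rfl | simp at hab

/-- In the metric of positions on a line all triangles contain `y` and `z`. -/
theorem col_of_lineDist {m : ℕ} {W : WeightedGraph (Vertex m)} {wt : Vertex m → Vertex m → ℕ}
    {pos : Vertex m → ℕ} {c : ℕ} (h : W.IsNatDist wt (lineDist pos c)) {u v w : Vertex m}
    (hy : (u ≠ .y ∧ v ≠ .y ∧ w ≠ .y) ∨ (u ≠ .z ∧ v ≠ .z ∧ w ≠ .z)) :
    W.betweenness.Col u v w := by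
  simp only [Col, h.rel_iff]
  rw [lineDist_eq pos c (a := u) (b := v) (by tauto),
    lineDist_eq pos c (a := v) (b := w) (by tauto),
    lineDist_eq pos c (a := u) (b := w) (by tauto), lineDist_eq pos c (a := v) (b := u) (by tauto),
    lineDist_eq pos c (a := w) (b := v) (by tauto)]
  omega

/-- All triangles contain `y` and `z`, and the third point may be any of the `m` others except `x j`
and `x k`. -/
theorem coSize_of_lineDist {m : ℕ} {W : WeightedGraph (Vertex m)} {wt : Vertex m → Vertex m → ℕ}
    {pos : Vertex m → ℕ} {c : ℕ} (h : W.IsNatDist wt (lineDist pos c)) {j k : Fin m} (hjk : j ≠ k)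
    (hcol : ∀ l, W.betweenness.Col .y .z (.x l) ↔ l = j ∨ l = k) :
    W.betweenness.coSize + 2 = m := by
  have := h.almostMetrizable.coSize_add_card (y := .y) (z := .z) (by simp) (fun T hT => ?_)
    {.x j, .x k} (fun w => ?_)
  · rw [card_vertex, Finset.card_pair (by simpa using hjk)] at this
    omega
  · obtain ⟨a, b, c, -, -, -, hn, rfl⟩ := hT.exists_triple
    by_contra hyz
    simp only [Finset.mem_insert, Finset.mem_singleton] at hyz
    refine hn (col_of_lineDist h ?_)
    simp only [ne_eq, @eq_comm _ a, @eq_comm _ b, @eq_comm _ c]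
    tauto
  · rcases w with l | _ | _
    · simp [hcol]
    · simp
    · simp

/-- A path vertex is equally far from `y` and `z`, and these are at distance two, so collinearity
means distance one: only `x_i` and `x_{i+1}` qualify. -/
theorem coSize_r4 {n i : ℕ} (hi : 1 ≤ i) (hin : i + 3 ≤ n) :
    (r4 n i).betweenness.coSize + 4 = n := by
  have h := isNatDist_r4 hi hin
  have := coSize_of_lineDist h (j := ⟨i - 1, by omega⟩) (k := ⟨i, by omega⟩)
    (by simp only [ne_eq, Fin.ext_iff]; omega) (fun l => by
      simp only [Col, h.rel_iff, lineDist, r4Pos, Fin.ext_iff]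
      split_ifs <;> omega)
  omega

/-- The distances of `x_j` from `y` and `z` are `j` and `n - 1 - j`. With `n - 3` between `y` and
`z`, collinearity holds only for `j = 1` and `j = n - 2`. -/
theorem coSize_s4 {n : ℕ} (hn : 5 ≤ n) : (s4 n hn).betweenness.coSize + 4 = n := by
  have h := isNatDist_s4 hn
  have := coSize_of_lineDist h (j := ⟨0, by omega⟩) (k := ⟨n - 3, by omega⟩)
    (by simp only [ne_eq, Fin.ext_iff]; omega) (fun l => by
      simp only [Col, h.rel_iff, lineDist, s4Pos, Fin.ext_iff]
      omega)
  omega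

end WeightedGraph

/-! ### Structures described by two orders -/

namespace BetweennessStructure

variable {X : Type*} {B : BetweennessStructure X}

/-- The functions `f` and `g` order the points other than `z` and other than `y`, and agree on the
points other than `y` and `z`. -/
structure TwoOrders (B : BetweennessStructure X) (y z : X) (f g : X → ℤ) : Prop where
  ne : y ≠ z
  inj_left : ∀ u v, u ≠ z → v ≠ z → f u = f v → u = v
  inj_right : ∀ u v, u ≠ y → v ≠ y → g u = g v → u = v
  rel_left : ∀ u v w, u ≠ z → v ≠ z → w ≠ z → f u ≤ f v → f v ≤ f w → B.rel u v w
  rel_right : ∀ u v w, u ≠ y → v ≠ y → w ≠ y → g u ≤ g v → g v ≤ g w → B.rel u v w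
  lt : ∀ u v, u ≠ y → u ≠ z → v ≠ y → v ≠ z → f u < f v → g u < g v

namespace TwoOrders

variable {y z : X} {f g : X → ℤ}

theorem swap (h : B.TwoOrders y z f g) : B.TwoOrders z y g f where
  ne := h.ne.symm
  inj_left := h.inj_right
  inj_right := h.inj_left
  rel_left := h.rel_right
  rel_right := h.rel_left
  lt u v huz huy hvz hvy huv := by
    rcases lt_trichotomy (f u) (f v) with h' | h' | h'
    · exact h'
    · rw [h.inj_left u v huz hvz h'] at huv
      exact absurd huv (lt_irrefl _)
    · exact absurd (h.lt v u hvy hvz huy huz h') (not_lt.2 huv.le)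

theorem neg (hB : B.AlmostMetrizable) (h : B.TwoOrders y z f g) :
    B.TwoOrders y z (fun u => -f u) (fun u => -g u) where
  ne := h.ne
  inj_left u v hu hv huv := h.inj_left u v hu hv (neg_injective huv)
  inj_right u v hu hv huv := h.inj_right u v hu hv (neg_injective huv)
  rel_left u v w hu hv hw h1 h2 :=
    hB.p2 _ _ _ (h.rel_left w v u hw hv hu (neg_le_neg_iff.1 h2) (neg_le_neg_iff.1 h1))
  rel_right u v w hu hv hw h1 h2 :=
    hB.p2 _ _ _ (h.rel_right w v u hw hv hu (neg_le_neg_iff.1 h2) (neg_le_neg_iff.1 h1))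
  lt u v huy huz hvy hvz huv :=
    neg_lt_neg (h.lt v u hvy hvz huy huz (neg_lt_neg_iff.1 huv))

/-- If some point between `y` and `z` in the two orders is between `y` and `z` in the structure,
then no triangle contains `y` and `z`. -/
theorem col_of_rel_between (hB : B.AlmostMetrizable) (h : B.TwoOrders y z f g) {j : X}
    (hjy : j ≠ y) (hjz : j ≠ z) (h1 : f y < f j) (h2 : g j < g z) (hr : B.rel y j z) {k : X}
    (hky : k ≠ y) (hkz : k ≠ z) : B.Col y z k := by
  rcases lt_trichotomy (f k) (f j) with hk | hk | hk
  · have hk' := h.lt k j hky hkz hjy hjz hk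
    rcases le_total (f k) (f y) with hy | hy
    · exact Or.inr (Or.inl (hB.p2 _ _ _ (hB.p4 _ _ _ _
        (h.rel_right k j z hky hjy h.ne.symm hk'.le h2.le)
        (h.rel_left k y j hkz h.ne hjz hy h1.le)).1))
    · exact Or.inr (Or.inr (hB.p4 _ _ _ _ hr (h.rel_left y k j h.ne hkz hjz hy hk.le)).1)
  · rw [h.inj_left k j hkz hjz hk]
    exact Or.inr (Or.inr hr)
  · have hk' := h.lt j k hjy hjz hky hkz hk
    rcases le_total (g z) (g k) with hz | hz
    · exact Or.inl (hB.p2 _ _ _ (hB.p4 _ _ _ _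
        (hB.p2 _ _ _ (h.rel_left y j k h.ne hjz hkz h1.le hk.le))
        (hB.p2 _ _ _ (h.rel_right j z k hjy h.ne.symm hky h2.le hz))).1)
    · exact Or.inr (Or.inr (hB.p2 _ _ _ (hB.p4 _ _ _ _ (hB.p2 _ _ _ hr)
        (hB.p2 _ _ _ (h.rel_right j k z hjy hky h.ne.symm hk'.le hz))).1))

/-- Since `t` forms a triangle with `y` and `z`, `j` is not between them in the structure. A point
`k` on the far side of `y` in `f` would give `k y j` and `k j z`, hence `y j z` by the four
relations property; the other side is symmetric. -/
theorem forall_between (hB : B.AlmostMetrizable) (h : B.TwoOrders y z f g) {j t : X}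
    (hjy : j ≠ y) (hjz : j ≠ z) (h1 : f y < f j) (h2 : g j < g z)
    (hty : t ≠ y) (htz : t ≠ z) (ht : ¬ B.Col y z t) {k : X} (hky : k ≠ y) (hkz : k ≠ z) :
    f y < f k ∧ g k < g z := by
  have hr : ¬ B.rel y j z := fun hr => ht (h.col_of_rel_between hB hjy hjz h1 h2 hr hty htz)
  constructor
  · by_contra! hk
    refine hr (hB.p4 k j z y (h.rel_right _ _ _ hky hjy h.ne.symm ?_ h2.le)
      (h.rel_left _ _ _ hkz h.ne hjz hk h1.le)).2
    exact (h.lt k j hky hkz hjy hjz (hk.trans_lt h1)).le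
  · by_contra! hk
    refine hr (hB.p2 _ _ _ (hB.p4 k j y z (hB.p2 _ _ _ (h.rel_left _ _ _ h.ne hjz hkz h1.le ?_))
      (hB.p2 _ _ _ (h.rel_right _ _ _ hjy h.ne.symm hky h2.le hk))).2)
    exact (h.swap.lt j k hjz hjy hkz hky (h2.trans_le hk)).le

/-- For a point `j` before `k`, the first order gives `y j k`, and together with `k y z` this gives
`k j z`; the second order gives `j k z`, a contradiction. -/
theorem min_of_rel (hB : B.AlmostMetrizable) (h : B.TwoOrders y z f g)
    (hall : ∀ k, k ≠ y → k ≠ z → f y < f k ∧ g k < g z) {k j : X} (hky : k ≠ y) (hkz : k ≠ z)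
    (hr : B.rel k y z) (hjy : j ≠ y) (hjz : j ≠ z) : f k ≤ f j := by
  by_contra! hlt
  refine hB.not_rel_left (fun h => ?_) (hB.p4 k y z j hr (hB.p2 _ _ _
    (h.rel_left y j k h.ne hjz hkz (hall j hjy hjz).1.le hlt.le))).1
    (h.rel_right j k z hjy hky h.ne.symm (h.lt j k hjy hjz hky hkz hlt).le (hall k hky hkz).2.le)
  subst h
  exact lt_irrefl _ hlt

theorem max_of_rel (hB : B.AlmostMetrizable) (h : B.TwoOrders y z f g)
    (hall : ∀ k, k ≠ y → k ≠ z → f y < f k ∧ g k < g z) {k j : X} (hky : k ≠ y) (hkz : k ≠ z)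
    (hr : B.rel y z k) (hjy : j ≠ y) (hjz : j ≠ z) : f j ≤ f k := by
  -- The mirror image: exchange `y` and `z` and reverse both orders.
  have := min_of_rel hB (h.swap.neg hB) (fun u huz huy =>
    ⟨neg_lt_neg (hall u huy huz).2, neg_lt_neg (hall u huy huz).1⟩) hkz hky (hB.p2 _ _ _ hr) hjz hjy
  by_contra! hlt
  have := h.lt k j hky hkz hjy hjz hlt
  omega

/-- If `y` and `z` have the same place in the order and some triangle contains both, then a point
collinear with `y` and `z` is between them. -/
theorem rel_of_col (hB : B.AlmostMetrizable) (h : B.TwoOrders y z f g)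
    (hcut : ∀ k, k ≠ y → k ≠ z → (f k < f y ↔ g k < g z)) {t : X}
    (hty : t ≠ y) (htz : t ≠ z) (ht : ¬ B.Col y z t) {k : X} (hky : k ≠ y) (hkz : k ≠ z)
    (hcol : B.Col y z k) : B.rel y k z := by
  -- A point `k` before the common place with `y` between `k` and `z` makes every point collinear
  -- with `y` and `z`, which `t` forbids. The case of `k` after that place follows by reversing the
  -- orders (`main'`), and that of `z` between `y` and `k` by exchanging `y` and `z`.
  have main : ∀ {y z : X} {f g : X → ℤ}, B.TwoOrders y z f g →
      (∀ k, k ≠ y → k ≠ z → (f k < f y ↔ g k < g z)) → ∀ k, k ≠ y → k ≠ z → f k < f y →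
      B.rel k y z → ∀ j, j ≠ y → j ≠ z → B.Col y z j := by
    intro y z f g h hcut k hky hkz hlt hr j hjy hjz
    have hlt' := (hcut k hky hkz).1 hlt
    rcases le_total (f j) (f y) with hj | hj
    · rcases lt_trichotomy (f j) (f k) with hjk | hjk | hjk
      · exact Or.inr (Or.inl (hB.p4 z k j y (hB.p2 _ _ _ (h.rel_right j k z hjy hky h.ne.symm
          (h.lt j k hjy hjz hky hkz hjk).le hlt'.le)) (hB.p2 _ _ _ hr)).1)
      · rw [h.inj_left j k hjz hkz hjk]
        exact Or.inr (Or.inl (hB.p2 _ _ _ hr))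
      · exact Or.inr (Or.inl (hB.p2 _ _ _ (hB.p4 k y z j hr
          (h.rel_left k j y hkz hjz h.ne hjk.le hj)).2))
    · have hzj : g z ≤ g j := not_lt.1 fun hz => absurd ((hcut j hjy hjz).2 hz) (not_lt.2 hj)
      exact Or.inl (hB.p4 k z j y (h.rel_right k z j hky h.ne.symm hjy hlt'.le hzj) hr).2
  have main' : ∀ {y z : X} {f g : X → ℤ}, B.TwoOrders y z f g →
      (∀ k, k ≠ y → k ≠ z → (f k < f y ↔ g k < g z)) → ∀ k, k ≠ y → k ≠ z →
      B.rel k y z → ∀ j, j ≠ y → j ≠ z → B.Col y z j := by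
    intro y z f g h hcut k hky hkz hr
    have hne : ∀ u, u ≠ y → u ≠ z → f u ≠ f y ∧ g u ≠ g z := fun u huy huz =>
      ⟨fun h' => huy (h.inj_left u y huz h.ne h'), fun h' => huz (h.inj_right u z huy h.ne.symm h')⟩
    rcases lt_or_ge (f k) (f y) with hlt | hge
    · exact main h hcut k hky hkz hlt hr
    · refine main (h.neg hB) (fun u huy huz => ?_) k hky hkz ?_ hr
      · have := hcut u huy huz
        have := hne u huy huz
        omega
      · have := (hne k hky hkz).1
        omega
  rcases hcol with hc | hc | hc
  · exact absurd (hB.col_swap_left (main' h.swap (fun u huz huy => (hcut u huy huz).symm) k hkz hky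
      (hB.p2 _ _ _ hc) t htz hty)) ht
  · exact absurd (main' h hcut k hky hkz (hB.p2 _ _ _ hc) t hty htz) ht
  · exact hc

/-- Only a neighbour of the common place can be between `y` and `z`. If `j` came after `k` but
before that place, `y j k` and `y k z` would give `j k z`, whereas the second order gives `k j z`.
-/
theorem not_between_of_rel (hB : B.AlmostMetrizable) (h : B.TwoOrders y z f g)
    (hcut : ∀ k, k ≠ y → k ≠ z → (f k < f y ↔ g k < g z)) {k j : X} (hky : k ≠ y) (hkz : k ≠ z)
    (hr : B.rel y k z) (hjy : j ≠ y) (hjz : j ≠ z) (hkj : f k < f j) : ¬ f j < f y := by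
  intro hj
  exact hB.not_rel_left (fun h => hkj.ne (by rw [h]))
    (h.rel_right k j z hky hjy h.ne.symm (h.lt k j hky hkz hjy hjz hkj).le
      ((hcut j hjy hjz).1 hj).le)
    (hB.p4 y k z j hr (hB.p2 _ _ _ (h.rel_left k j y hkz hjz h.ne hkj.le hj.le))).2

theorem cut_neg (h : B.TwoOrders y z f g)
    (hcut : ∀ k, k ≠ y → k ≠ z → (f k < f y ↔ g k < g z)) (k : X) (hky : k ≠ y) (hkz : k ≠ z) :
    -f k < -f y ↔ -g k < -g z := by
  have h1 : f k ≠ f y := fun h' => hky (h.inj_left k y hkz h.ne h')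
  have h2 : g k ≠ g z := fun h' => hkz (h.inj_right k z hky h.ne.symm h')
  have := hcut k hky hkz
  omega

end TwoOrders

/-- Two orders of the same linear structure agree up to reversal. -/
theorem AlmostMetrizable.order_unique (hB : B.AlmostMetrizable) {M : Finset X} {f g : X → ℤ}
    (hM : M.Nonempty) (hg : Set.InjOn g M)
    (hfr : ∀ x ∈ M, ∀ y ∈ M, ∀ z ∈ M, f x ≤ f y → f y ≤ f z → B.rel x y z)
    (hgr : ∀ x ∈ M, ∀ y ∈ M, ∀ z ∈ M, g x ≤ g y → g y ≤ g z → B.rel x y z) :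
    (∀ u ∈ M, ∀ v ∈ M, f u < f v → g u < g v) ∨ (∀ u ∈ M, ∀ v ∈ M, f u < f v → g v < g u) := by
  have mono : ∀ g : X → ℤ, Set.InjOn g M →
      (∀ x ∈ M, ∀ y ∈ M, ∀ z ∈ M, g x ≤ g y → g y ≤ g z → B.rel x y z) → ∀ a ∈ M, ∀ b ∈ M,
      (∀ u ∈ M, f a ≤ f u) → (∀ u ∈ M, f u ≤ f b) → g a ≤ g b →
      ∀ u ∈ M, ∀ v ∈ M, f u < f v → g u < g v := by
    intro g hg hgr a ha b hb hmin hmax hab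
    -- The middle point of a betweenness also has the middle value under `g`, since any other
    -- arrangement of values would give a second middle point.
    have between : ∀ u ∈ M, ∀ v ∈ M, ∀ w ∈ M, u ≠ v → v ≠ w → B.rel u v w →
        (g u ≤ g v ∧ g v ≤ g w) ∨ (g w ≤ g v ∧ g v ≤ g u) := by
      intro u hu v hv w hw huv hvw h
      rcases le_total (g u) (g v) with h1 | h1 <;> rcases le_total (g v) (g w) with h2 | h2
      · exact Or.inl ⟨h1, h2⟩
      · rcases le_total (g u) (g w) with h3 | h3
        · exact absurd (hgr u hu w hw v hv h3 h2) (hB.not_rel_right hvw h)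
        · exact absurd (hB.p2 _ _ _ (hgr w hw u hu v hv h3 h1)) (hB.not_rel_left huv h)
      · rcases le_total (g u) (g w) with h3 | h3
        · exact absurd (hgr v hv u hu w hw h1 h3) (hB.not_rel_left huv h)
        · exact absurd (hB.p2 _ _ _ (hgr v hv w hw u hu h2 h3)) (hB.not_rel_right hvw h)
      · exact Or.inr ⟨h2, h1⟩
    -- Every point is between the two ends `a` and `b` of `f`, so its value under `g` is at least
    -- the smaller end value `g a`.
    have hale : ∀ v ∈ M, g a ≤ g v := by
      intro v hv
      by_cases hva : v = a
      · rw [hva]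
      by_cases hvb : v = b
      · rwa [hvb]
      rcases between a ha v hv b hb (Ne.symm hva) hvb (hfr a ha v hv b hb (hmin v hv) (hmax v hv))
        with h | h
      · exact h.1
      · exact hab.trans h.1
    intro u hu v hv huv
    have hne : u ≠ v := fun h => huv.ne (by rw [h])
    refine lt_of_le_of_ne ?_ fun h => hne (hg hu hv h)
    by_cases hua : u = a
    · rw [hua]; exact hale v hv
    rcases between a ha u hu v hv (Ne.symm hua) hne (hfr a ha u hu v hv (hmin u hu) huv.le)
      with h | h
    · exact h.2
    · exact h.2.trans (hale v hv)
  obtain ⟨a, ha, hmin⟩ := M.exists_min_image f hM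
  obtain ⟨b, hb, hmax⟩ := M.exists_max_image f hM
  rcases le_total (g a) (g b) with hab | hab
  · exact Or.inl (mono g hg hgr a ha b hb hmin hmax hab)
  · right
    intro u hu v hv huv
    have := mono (fun u => -g u) (fun u hu v hv h => hg hu hv (neg_injective h))
      (fun x hx y hy z hz h1 h2 => hB.p2 _ _ _ (hgr z hz y hy x hx (neg_le_neg_iff.1 h2)
        (neg_le_neg_iff.1 h1))) a ha b hb hmin hmax (neg_le_neg hab) u hu v hv huv
    exact neg_lt_neg_iff.1 this

/-- Without `z`, or without `y`, at least five points remain and no triangle, so each part is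
linear. On the common points the two orders agree up to reversal, and `g` is negated if necessary.
-/
theorem AlmostMetrizable.exists_twoOrders [Fintype X] [DecidableEq X] (hB : B.AlmostMetrizable)
    (hX : 6 ≤ Fintype.card X) {y z : X} (hyz : y ≠ z) (h : ∀ T, B.IsTriangle T → y ∈ T ∧ z ∈ T) :
    ∃ f g, B.TwoOrders y z f g := by
  have hcard : ∀ w : X, 5 ≤ (Finset.univ.erase w).card := by
    intro w
    rw [Finset.card_erase_of_mem (Finset.mem_univ w), Finset.card_univ]
    omega
  obtain ⟨f, hf, hfr⟩ := hB.exists_order (hcard z)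
    (fun T hT hT' => Finset.notMem_erase z _ (hT (h T hT').2))
  obtain ⟨g, hg, hgr⟩ := hB.exists_order (hcard y)
    (fun T hT hT' => Finset.notMem_erase y _ (hT (h T hT').1))
  have hM : ((Finset.univ.erase y).erase z).Nonempty := by
    rw [← Finset.card_pos, Finset.card_erase_of_mem (by simp [hyz.symm])]
    have := hcard y
    omega
  have memz : ∀ {u}, u ∈ Finset.univ.erase z ↔ u ≠ z := by simp
  have memy : ∀ {u}, u ∈ Finset.univ.erase y ↔ u ≠ y := by simp
  have subz : ∀ {u}, u ∈ (Finset.univ.erase y).erase z → u ∈ Finset.univ.erase z :=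
    fun hu => memz.2 (Finset.ne_of_mem_erase hu)
  have suby : ∀ {u}, u ∈ (Finset.univ.erase y).erase z → u ∈ Finset.univ.erase y :=
    fun hu => Finset.mem_of_mem_erase hu
  have memM : ∀ {u}, u ≠ y → u ≠ z → u ∈ (Finset.univ.erase y).erase z :=
    fun hy hz => by simp [hy, hz]
  rcases hB.order_unique hM (f := f) (g := g)
    (fun u hu v hv => hg (suby hu) (suby hv))
    (fun u hu v hv w hw => hfr u (subz hu) v (subz hv) w (subz hw))
    (fun u hu v hv w hw => hgr u (suby hu) v (suby hv) w (suby hw)) with hlt | hlt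
  · exact ⟨f, g, hyz, fun u v hu hv => hf (memz.2 hu) (memz.2 hv),
      fun u v hu hv => hg (memy.2 hu) (memy.2 hv),
      fun u v w hu hv hw => hfr u (memz.2 hu) v (memz.2 hv) w (memz.2 hw),
      fun u v w hu hv hw => hgr u (memy.2 hu) v (memy.2 hv) w (memy.2 hw),
      fun u v huy huz hvy hvz => hlt u (memM huy huz) v (memM hvy hvz)⟩
  · exact ⟨f, fun u => -g u, hyz, fun u v hu hv => hf (memz.2 hu) (memz.2 hv),
      fun u v hu hv h => hg (memy.2 hu) (memy.2 hv) (neg_injective h),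
      fun u v w hu hv hw => hfr u (memz.2 hu) v (memz.2 hv) w (memz.2 hw),
      fun u v w hu hv hw h1 h2 => hB.p2 _ _ _ (hgr w (memy.2 hw) v (memy.2 hv) u (memy.2 hu)
        (neg_le_neg_iff.1 h2) (neg_le_neg_iff.1 h1)),
      fun u v huy huz hvy hvz h => neg_lt_neg (hlt u (memM huy huz) v (memM hvy hvz) h)⟩

/-- The points of a finite set in the order of the values of an injective function. -/
theorem exists_enumeration {M : Finset X} {f : X → ℤ} (hf : Set.InjOn f M) {m : ℕ}
    (hm : M.card = m) : ∃ l : Fin m → X, (∀ j, l j ∈ M) ∧ (∀ j k, j < k → f (l j) < f (l k)) ∧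
      ∀ u ∈ M, ∃ j, l j = u := by
  have hcard : (M.image f).card = m := by rw [Finset.card_image_of_injOn hf, hm]
  have hex : ∀ j, ∃ u ∈ M, f u = (M.image f).orderEmbOfFin hcard j := fun j =>
    Finset.mem_image.1 (Finset.orderEmbOfFin_mem _ hcard j)
  choose l hl hfl using hex
  refine ⟨l, hl, fun j k hjk => ?_, fun u hu => ?_⟩
  · rw [hfl, hfl]
    exact ((M.image f).orderEmbOfFin hcard).strictMono hjk
  · have : f u ∈ Set.range ((M.image f).orderEmbOfFin hcard) := by
      rw [Finset.range_orderEmbOfFin]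
      exact Finset.mem_coe.2 (Finset.mem_image_of_mem f hu)
    obtain ⟨j, hj⟩ := this
    exact ⟨j, hf (hl j) hu (by rw [hfl, hj])⟩

end BetweennessStructure

/-! ### Recognizing the two infinite families -/

namespace BetweennessStructure

open WeightedGraph

variable {X : Type*} {B : BetweennessStructure X}

/-- The map from the vertices of `R⁴_{n,i}` or `S⁴_n` given by an enumeration and two points. -/
def vertexMap {m : ℕ} (l : Fin m → X) (y z : X) : Vertex m → X
  | .x j => l j
  | .y => y
  | .z => z

/-- Triples that miss `y` or `z` are governed by the orders in `B` and by the positions in the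
graph, and these match. Only triples with `y`, `z` and one further point have to be compared
separately, which is the role of `hyz`. -/
theorem TwoOrders.iso_of_lineDist [Fintype X] {y z : X} {f g : X → ℤ}
    (hB : B.AlmostMetrizable) (h : B.TwoOrders y z f g) {m : ℕ} (hm : Fintype.card X = m + 2)
    {l : Fin m → X} (hly : ∀ j, l j ≠ y) (hlz : ∀ j, l j ≠ z)
    (hl : ∀ j k, j < k → f (l j) < f (l k))
    {W : WeightedGraph (Vertex m)} {wt : Vertex m → Vertex m → ℕ}
    {pos : Vertex m → ℕ} {c : ℕ} (hW : W.IsNatDist wt (lineDist pos c))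
    (hf : ∀ u v, u ≠ .z → v ≠ .z → pos u ≤ pos v → f (vertexMap l y z u) ≤ f (vertexMap l y z v))
    (hg : ∀ u v, u ≠ .y → v ≠ .y → pos u ≤ pos v → g (vertexMap l y z u) ≤ g (vertexMap l y z v))
    (hyz : ∀ j, (W.betweenness.rel .y .z (.x j) → B.rel y z (l j)) ∧
      (W.betweenness.rel .z .y (.x j) → B.rel z y (l j)) ∧
      (W.betweenness.rel .y (.x j) .z → B.rel y (l j) z) ∧
      (B.Col y z (l j) → W.betweenness.Col .y .z (.x j))) :
    B.Iso W.betweenness := by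
  have hC := hW.almostMetrizable
  have hlinj : Function.Injective l := by
    intro j k hjk
    rcases lt_trichotomy j k with h' | h' | h'
    · exact absurd (congrArg f hjk) (hl j k h').ne
    · exact h'
    · exact absurd (congrArg f hjk) (hl k j h').ne'
  have hinj : Function.Injective (vertexMap l y z) := by
    intro u v huv
    rcases u with u | _ | _ <;> rcases v with v | _ | _ <;> simp only [vertexMap] at huv
    · rw [hlinj huv]
    · exact absurd huv (hly u)
    · exact absurd huv (hlz u)
    · exact absurd huv.symm (hly v)
    · rfl
    · exact absurd huv h.ne
    · exact absurd huv.symm (hlz v)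
    · exact absurd huv.symm h.ne
    · rfl
  have hbij : Function.Bijective (vertexMap l y z) :=
    (Fintype.bijective_iff_injective_and_card _).2 ⟨hinj, by rw [card_vertex, hm]⟩
  have hrel_left : ∀ u v w, u ≠ .z → v ≠ .z → w ≠ .z → W.betweenness.rel u v w →
      B.rel (vertexMap l y z u) (vertexMap l y z v) (vertexMap l y z w) := by
    intro u v w hu hv hw hr
    have hne : ∀ u : Vertex m, u ≠ .z → vertexMap l y z u ≠ z := fun u hu h' => hu (hinj h')
    rw [hW.rel_iff, lineDist_eq _ _ (Or.inr ⟨hu, hv⟩), lineDist_eq _ _ (Or.inr ⟨hv, hw⟩),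
      lineDist_eq _ _ (Or.inr ⟨hu, hw⟩)] at hr
    obtain ⟨h1, h2⟩ | ⟨h1, h2⟩ : (pos u ≤ pos v ∧ pos v ≤ pos w) ∨
      (pos w ≤ pos v ∧ pos v ≤ pos u) := by omega
    · exact h.rel_left _ _ _ (hne u hu) (hne v hv) (hne w hw) (hf u v hu hv h1) (hf v w hv hw h2)
    · exact hB.p2 _ _ _ (h.rel_left _ _ _ (hne w hw) (hne v hv) (hne u hu) (hf w v hw hv h1)
        (hf v u hv hu h2))
  have hrel_right : ∀ u v w, u ≠ .y → v ≠ .y → w ≠ .y → W.betweenness.rel u v w →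
      B.rel (vertexMap l y z u) (vertexMap l y z v) (vertexMap l y z w) := by
    intro u v w hu hv hw hr
    have hne : ∀ u : Vertex m, u ≠ .y → vertexMap l y z u ≠ y := fun u hu h' => hu (hinj h')
    rw [hW.rel_iff, lineDist_eq _ _ (Or.inl ⟨hu, hv⟩), lineDist_eq _ _ (Or.inl ⟨hv, hw⟩),
      lineDist_eq _ _ (Or.inl ⟨hu, hw⟩)] at hr
    obtain ⟨h1, h2⟩ | ⟨h1, h2⟩ : (pos u ≤ pos v ∧ pos v ≤ pos w) ∨
      (pos w ≤ pos v ∧ pos v ≤ pos u) := by omega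
    · exact h.rel_right _ _ _ (hne u hu) (hne v hv) (hne w hw) (hg u v hu hv h1) (hg v w hv hw h2)
    · exact hB.p2 _ _ _ (h.rel_right _ _ _ (hne w hw) (hne v hv) (hne u hu) (hg w v hw hv h1)
        (hg v u hv hu h2))
  have hL : ∀ {u v w}, B.Col u v w → B.Col v u w := hB.col_swap_left
  have hR : ∀ {u v w}, B.Col u v w → B.Col u w v := hB.col_swap_right
  have hL' : ∀ {u v w}, W.betweenness.Col u v w → W.betweenness.Col v u w := hC.col_swap_left
  have hR' : ∀ {u v w}, W.betweenness.Col u v w → W.betweenness.Col u w v := hC.col_swap_right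
  have h1 := fun j => (hyz j).1
  have h2 := fun j => (hyz j).2.1
  have h3 := fun j => (hyz j).2.2.1
  have h4 := fun j => (hyz j).2.2.2
  refine Iso.of_equiv hB hC (Equiv.ofBijective _ hbij) (fun u v w huv hvw huw hr => ?_)
    (fun u v w huv hvw huw hn hc => hn ?_)
  · simp only [Equiv.ofBijective_apply]
    by_cases hz : u ≠ .z ∧ v ≠ .z ∧ w ≠ .z
    · exact hrel_left u v w hz.1 hz.2.1 hz.2.2 hr
    by_cases hy : u ≠ .y ∧ v ≠ .y ∧ w ≠ .y
    · exact hrel_right u v w hy.1 hy.2.1 hy.2.2 hr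
    rcases u with u | _ | _ <;> rcases v with v | _ | _ <;> rcases w with w | _ | _ <;>
      first
      | exact absurd rfl huv
      | exact absurd rfl hvw
      | exact absurd rfl huw
      | (simp at hz; done)
      | (simp at hy; done)
      | skip
    · exact hB.p2 _ _ _ (h2 u (hC.p2 _ _ _ hr))
    · exact hB.p2 _ _ _ (h1 u (hC.p2 _ _ _ hr))
    · exact h3 v hr
    · exact h1 w hr
    · exact hB.p2 _ _ _ (h3 v (hC.p2 _ _ _ hr))
    · exact h2 w hr
  · simp only [Equiv.ofBijective_apply] at hc
    by_cases hz : u ≠ .z ∧ v ≠ .z ∧ w ≠ .z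
    · exact col_of_lineDist hW (Or.inr hz)
    by_cases hy : u ≠ .y ∧ v ≠ .y ∧ w ≠ .y
    · exact col_of_lineDist hW (Or.inl hy)
    rcases u with u | _ | _ <;> rcases v with v | _ | _ <;> rcases w with w | _ | _ <;>
      first
      | exact absurd rfl huv
      | exact absurd rfl hvw
      | exact absurd rfl huw
      | (simp at hz; done)
      | (simp at hy; done)
      | skip
    · exact hL' (hR' (h4 u (hR (hL hc))))
    · exact hL' (hR' (hL' (h4 u (hL (hR (hL hc))))))
    · exact hR' (h4 v (hR hc))
    · exact h4 w hc
    · exact hR' (hL' (h4 v (hL (hR hc))))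
    · exact hL' (h4 w (hL hc))

/-- All points lie between `y` and `z` in the orders, yet none is between them in the structure. A
point collinear with them is thus beyond `y`, and then it is the first point, or beyond `z`, and
then it is the last. Two distinct such points must be one of each kind. -/
theorem TwoOrders.iso_s4 [Fintype X] [DecidableEq X] {y z : X} {f g : X → ℤ}
    (hB : B.AlmostMetrizable) (h : B.TwoOrders y z f g) {n : ℕ} (hn : 5 ≤ n)
    (hX : Fintype.card X = n) {t : X} (hty : t ≠ y) (htz : t ≠ z) (ht : ¬ B.Col y z t) {a b : X}
    (hab : a ≠ b) (hN : ∀ w, w ≠ y → w ≠ z → (B.Col y z w ↔ w = a ∨ w = b))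
    (hay : a ≠ y) (haz : a ≠ z) (hby : b ≠ y) (hbz : b ≠ z) {j : X}
    (hjy : j ≠ y) (hjz : j ≠ z) (h1 : f y < f j) (h2 : g j < g z) :
    B.Iso (s4 n hn).betweenness := by
  have hall : ∀ k, k ≠ y → k ≠ z → f y < f k ∧ g k < g z := fun k hky hkz =>
    h.forall_between hB hjy hjz h1 h2 hty htz ht hky hkz
  have hcol : ∀ k, k ≠ y → k ≠ z → B.Col y z k → B.rel k y z ∨ B.rel y z k := by
    intro k hky hkz hc
    rcases hc with hc | hc | hc
    · exact Or.inr hc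
    · exact Or.inl (hB.p2 _ _ _ hc)
    · exact absurd (h.col_of_rel_between hB hky hkz (hall k hky hkz).1 (hall k hky hkz).2 hc hty
        htz) ht
  have hminmax : ∃ a b, a ≠ y ∧ a ≠ z ∧ b ≠ y ∧ b ≠ z ∧ B.rel a y z ∧ B.rel y z b ∧
      ∀ w, w ≠ y → w ≠ z → B.Col y z w → w = a ∨ w = b := by
    have heq : ∀ {u v : X}, u ≠ z → v ≠ z → f u ≤ f v → f v ≤ f u → u = v :=
      fun hu hv h1 h2 => h.inj_left _ _ hu hv (le_antisymm h1 h2)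
    rcases hcol a hay haz ((hN a hay haz).2 (Or.inl rfl)) with ha | ha <;>
      rcases hcol b hby hbz ((hN b hby hbz).2 (Or.inr rfl)) with hb | hb
    · exact absurd (heq haz hbz (h.min_of_rel hB hall hay haz ha hby hbz)
        (h.min_of_rel hB hall hby hbz hb hay haz)) hab
    · exact ⟨a, b, hay, haz, hby, hbz, ha, hb, fun w hwy hwz hw => (hN w hwy hwz).1 hw⟩
    · exact ⟨b, a, hby, hbz, hay, haz, hb, ha, fun w hwy hwz hw => ((hN w hwy hwz).1 hw).symm⟩
    · exact absurd (heq haz hbz (h.max_of_rel hB hall hby hbz hb hay haz)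
        (h.max_of_rel hB hall hay haz ha hby hbz)) hab
  clear hN hab hay haz hby hbz a b
  obtain ⟨a, b, hay, haz, hby, hbz, ha, hb, hN⟩ := hminmax
  have hM : ((Finset.univ.erase y).erase z).card = n - 2 := by
    rw [Finset.card_erase_of_mem (by simp [h.ne.symm]),
      Finset.card_erase_of_mem (Finset.mem_univ y), Finset.card_univ, hX]
    omega
  obtain ⟨l, hlM, hl, hsurj⟩ := exists_enumeration (f := f) (fun u hu v hv huv =>
    h.inj_left u v (Finset.ne_of_mem_erase hu) (Finset.ne_of_mem_erase hv) huv) hM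
  have hlz : ∀ j, l j ≠ z := fun j => Finset.ne_of_mem_erase (hlM j)
  have hly : ∀ j, l j ≠ y := fun j => Finset.ne_of_mem_erase (Finset.mem_of_mem_erase (hlM j))
  have hle : ∀ j k : Fin (n - 2), j.val ≤ k.val → f (l j) ≤ f (l k) := by
    intro j k hjk
    rcases hjk.lt_or_eq with hjk | hjk
    · exact (hl j k hjk).le
    · rw [Fin.ext hjk]
  have hle' : ∀ j k : Fin (n - 2), j.val ≤ k.val → g (l j) ≤ g (l k) := by
    intro j k hjk
    rcases hjk.lt_or_eq with hjk | hjk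
    · exact (h.lt _ _ (hly j) (hlz j) (hly k) (hlz k) (hl j k hjk)).le
    · rw [Fin.ext hjk]
  obtain ⟨ja, rfl⟩ := hsurj a (by simp [hay, haz])
  obtain ⟨jb, rfl⟩ := hsurj b (by simp [hby, hbz])
  have hja : ja.val = 0 := by
    by_contra hne
    exact absurd (h.min_of_rel hB hall hay haz ha (hly ⟨0, by omega⟩) (hlz _))
      (not_le.2 (hl ⟨0, by omega⟩ ja (Fin.lt_def.2 (by simp only; omega))))
  have hjb : jb.val = n - 3 := by
    by_contra hne
    exact absurd (h.max_of_rel hB hall hby hbz hb (hly ⟨n - 3, by omega⟩) (hlz _))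
      (not_le.2 (hl jb ⟨n - 3, by omega⟩ (Fin.lt_def.2 (by simp only; omega))))
  have hW := isNatDist_s4 hn
  refine h.iso_of_lineDist hB (by omega) hly hlz hl hW (fun u v hu hv huv => ?_)
    (fun u v hu hv huv => ?_) (fun j => ⟨fun hr => ?_, fun hr => ?_, fun hr => ?_, fun hc => ?_⟩)
  · rcases u with u | _ | _ <;> rcases v with v | _ | _ <;>
      simp only [vertexMap, s4Pos] at huv ⊢ <;>
      first
      | exact le_rfl
      | exact absurd rfl hu
      | exact absurd rfl hv
      | exact hle u v (by omega)
      | exact (hall _ (hly v) (hlz v)).1.le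
      | omega
  · rcases u with u | _ | _ <;> rcases v with v | _ | _ <;>
      simp only [vertexMap, s4Pos] at huv ⊢ <;>
      first
      | exact le_rfl
      | exact absurd rfl hu
      | exact absurd rfl hv
      | exact hle' u v (by omega)
      | exact (hall _ (hly u) (hlz u)).2.le
      | omega
  · have : j = jb := by
      simp only [hW.rel_iff, lineDist, s4Pos] at hr
      apply Fin.ext
      omega
    rwa [this]
  · have : j = ja := by
      simp only [hW.rel_iff, lineDist, s4Pos] at hr
      apply Fin.ext
      omega
    rw [this]
    exact hB.p2 _ _ _ ha
  · simp only [hW.rel_iff, lineDist, s4Pos] at hr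
    omega
  · have : j = ja ∨ j = jb := by
      rcases hN _ (hly j) (hlz j) hc with h' | h'
      · left
        by_contra hne
        rcases lt_or_gt_of_ne hne with h'' | h''
        · exact absurd (congrArg f h') (hl _ _ h'').ne
        · exact absurd (congrArg f h') (hl _ _ h'').ne'
      · right
        by_contra hne
        rcases lt_or_gt_of_ne hne with h'' | h''
        · exact absurd (congrArg f h') (hl _ _ h'').ne
        · exact absurd (congrArg f h') (hl _ _ h'').ne'
    simp only [Col, hW.rel_iff, lineDist, s4Pos]
    rcases this with rfl | rfl <;> omega

/-- Points collinear with `y` and `z` are between them, and are neighbours of their common place.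
Each side has only one neighbour, so the two points lie on opposite sides and are consecutive among
the remaining points. -/
theorem TwoOrders.iso_r4 [Fintype X] [DecidableEq X] {y z : X} {f g : X → ℤ}
    (hB : B.AlmostMetrizable) (h : B.TwoOrders y z f g) {n : ℕ}
    (hX : Fintype.card X = n) {t : X} (hty : t ≠ y) (htz : t ≠ z) (ht : ¬ B.Col y z t) {a b : X}
    (hab : a ≠ b) (hN : ∀ w, w ≠ y → w ≠ z → (B.Col y z w ↔ w = a ∨ w = b))
    (hay : a ≠ y) (haz : a ≠ z) (hby : b ≠ y) (hbz : b ≠ z)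
    (hcut : ∀ k, k ≠ y → k ≠ z → (f k < f y ↔ g k < g z)) :
    ∃ i, 1 ≤ i ∧ i + 3 ≤ n ∧ B.Iso (r4 n i).betweenness := by
  have hcol : ∀ k, k ≠ y → k ≠ z → B.Col y z k → B.rel y k z := fun k hky hkz hc =>
    h.rel_of_col hB hcut hty htz ht hky hkz hc
  have hlow : ∀ k, k ≠ y → k ≠ z → B.rel y k z → ∀ j, j ≠ y → j ≠ z → f k < f j →
      ¬ f j < f y := fun k hky hkz hr j hjy hjz => h.not_between_of_rel hB hcut hky hkz hr hjy hjz
  have hhigh : ∀ k, k ≠ y → k ≠ z → B.rel y k z → ∀ j, j ≠ y → j ≠ z → f j < f k →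
      ¬ f y < f j := by
    intro k hky hkz hr j hjy hjz hjk hj
    exact (h.neg hB).not_between_of_rel hB (h.cut_neg hcut) hky hkz hr hjy hjz (neg_lt_neg hjk)
      (neg_lt_neg hj)
  have hfne : ∀ k, k ≠ y → k ≠ z → f k ≠ f y := fun k hky hkz h' =>
    hky (h.inj_left k y hkz h.ne h')
  have hgne : ∀ k, k ≠ y → k ≠ z → g k ≠ g z := fun k hky hkz h' =>
    hkz (h.inj_right k z hky h.ne.symm h')
  have hsides : ∃ a b, a ≠ y ∧ a ≠ z ∧ b ≠ y ∧ b ≠ z ∧ f a < f y ∧ f y < f b ∧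
      B.rel y a z ∧ B.rel y b z ∧ ∀ w, w ≠ y → w ≠ z → B.Col y z w → w = a ∨ w = b := by
    have ha := hcol a hay haz ((hN a hay haz).2 (Or.inl rfl))
    have hb := hcol b hby hbz ((hN b hby hbz).2 (Or.inr rfl))
    have hfab : f a ≠ f b := fun h' => hab (h.inj_left a b haz hbz h')
    rcases lt_or_gt_of_ne (hfne a hay haz) with ha' | ha' <;>
      rcases lt_or_gt_of_ne (hfne b hby hbz) with hb' | hb'
    · rcases lt_or_gt_of_ne hfab with h' | h'
      · exact absurd hb' (hlow a hay haz ha b hby hbz h')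
      · exact absurd ha' (hlow b hby hbz hb a hay haz h')
    · exact ⟨a, b, hay, haz, hby, hbz, ha', hb', ha, hb,
        fun w hwy hwz hw => (hN w hwy hwz).1 hw⟩
    · exact ⟨b, a, hby, hbz, hay, haz, hb', ha', hb, ha,
        fun w hwy hwz hw => ((hN w hwy hwz).1 hw).symm⟩
    · rcases lt_or_gt_of_ne hfab with h' | h'
      · exact absurd ha' (hhigh b hby hbz hb a hay haz h')
      · exact absurd hb' (hhigh a hay haz ha b hby hbz h')
  clear hN hab hay haz hby hbz a b
  obtain ⟨a, b, hay, haz, hby, hbz, hfa, hfb, ha, hb, hN⟩ := hsides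
  have hM : ((Finset.univ.erase y).erase z).card = n - 2 := by
    rw [Finset.card_erase_of_mem (by simp [h.ne.symm]),
      Finset.card_erase_of_mem (Finset.mem_univ y), Finset.card_univ, hX]
    omega
  obtain ⟨l, hlM, hl, hsurj⟩ := exists_enumeration (f := f) (fun u hu v hv huv =>
    h.inj_left u v (Finset.ne_of_mem_erase hu) (Finset.ne_of_mem_erase hv) huv) hM
  have hlz : ∀ j, l j ≠ z := fun j => Finset.ne_of_mem_erase (hlM j)
  have hly : ∀ j, l j ≠ y := fun j => Finset.ne_of_mem_erase (Finset.mem_of_mem_erase (hlM j))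
  have hle : ∀ j k : Fin (n - 2), j.val ≤ k.val → f (l j) ≤ f (l k) := by
    intro j k hjk
    rcases hjk.lt_or_eq with hjk | hjk
    · exact (hl j k hjk).le
    · rw [Fin.ext hjk]
  have hle' : ∀ j k : Fin (n - 2), j.val ≤ k.val → g (l j) ≤ g (l k) := by
    intro j k hjk
    rcases hjk.lt_or_eq with hjk | hjk
    · exact (h.lt _ _ (hly j) (hlz j) (hly k) (hlz k) (hl j k hjk)).le
    · rw [Fin.ext hjk]
  obtain ⟨ja, rfl⟩ := hsurj a (by simp [hay, haz])
  obtain ⟨jb, rfl⟩ := hsurj b (by simp [hby, hbz])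
  have hbelow : ∀ j, j.val < ja.val + 1 → f (l j) < f y := fun j hj =>
    (hle j ja (by omega)).trans_lt hfa
  have habove : ∀ j, ¬ j.val < ja.val + 1 → f y < f (l j) := fun j hj =>
    lt_of_le_of_ne (not_lt.1 (hlow _ hay haz ha _ (hly j) (hlz j)
      (hl ja j (Fin.lt_def.2 (by omega))))) (hfne _ (hly j) (hlz j)).symm
  have hjb : jb.val = ja.val + 1 := by
    have h1 : ¬ jb.val < ja.val + 1 := fun h' => lt_asymm (hbelow jb h') hfb
    by_contra hne
    exact hhigh _ hby hbz hb (l ⟨ja.val + 1, by omega⟩) (hly _) (hlz _)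
      (hl ⟨ja.val + 1, by omega⟩ jb (Fin.lt_def.2 (by simp only; omega)))
      (habove ⟨ja.val + 1, by omega⟩ (by simp))
  have hbelow' : ∀ j, j.val < ja.val + 1 → g (l j) < g z := fun j hj =>
    (hcut _ (hly j) (hlz j)).1 (hbelow j hj)
  have habove' : ∀ j, ¬ j.val < ja.val + 1 → g z < g (l j) := fun j hj =>
    lt_of_le_of_ne (not_lt.1 fun h' => lt_asymm (habove j hj)
      ((hcut _ (hly j) (hlz j)).2 h')) (hgne _ (hly j) (hlz j)).symm
  have hin : ja.val + 1 + 3 ≤ n := by omega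
  have hW := isNatDist_r4 (i := ja.val + 1) (by omega) hin
  -- Since `ja` counts from zero, the last point before `y` and `z` is `x_i` with `i = ja + 1`.
  refine ⟨ja.val + 1, by omega, hin, h.iso_of_lineDist hB (by omega) hly hlz hl hW
    (fun u v hu hv huv => ?_) (fun u v hu hv huv => ?_)
    (fun j => ⟨fun hr => ?_, fun hr => ?_, fun hr => ?_, fun hc => ?_⟩)⟩
  · rcases u with u | _ | _ <;> rcases v with v | _ | _ <;>
      simp only [vertexMap, r4Pos] at huv ⊢ <;>
      first
      | exact le_rfl
      | exact absurd rfl hu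
      | exact absurd rfl hv
      | exact hle u v (by split_ifs at huv <;> omega)
      | exact (hbelow u (by split_ifs at huv <;> omega)).le
      | exact (habove v (by split_ifs at huv <;> omega)).le
  · rcases u with u | _ | _ <;> rcases v with v | _ | _ <;>
      simp only [vertexMap, r4Pos] at huv ⊢ <;>
      first
      | exact le_rfl
      | exact absurd rfl hu
      | exact absurd rfl hv
      | exact hle' u v (by split_ifs at huv <;> omega)
      | exact (hbelow' u (by split_ifs at huv <;> omega)).le
      | exact (habove' v (by split_ifs at huv <;> omega)).le
  · simp only [hW.rel_iff, lineDist, r4Pos] at hr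
    split_ifs at hr <;> omega
  · simp only [hW.rel_iff, lineDist, r4Pos] at hr
    split_ifs at hr <;> omega
  · have : j = ja ∨ j = jb := by
      simp only [hW.rel_iff, lineDist, r4Pos] at hr
      rw [Fin.ext_iff, Fin.ext_iff]
      split_ifs at hr <;> omega
    rcases this with rfl | rfl <;> assumption
  · have : j = ja ∨ j = jb := by
      rcases hN _ (hly j) (hlz j) hc with h' | h'
      · left
        by_contra hne
        rcases lt_or_gt_of_ne hne with h'' | h''
        · exact absurd (congrArg f h') (hl _ _ h'').ne
        · exact absurd (congrArg f h') (hl _ _ h'').ne'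
      · right
        by_contra hne
        rcases lt_or_gt_of_ne hne with h'' | h''
        · exact absurd (congrArg f h') (hl _ _ h'').ne
        · exact absurd (congrArg f h') (hl _ _ h'').ne'
    simp only [Col, hW.rel_iff, lineDist, r4Pos]
    rcases this with rfl | rfl <;> split_ifs <;> omega

/-- Reversing the path of `R⁴_{n,i}` gives `R⁴_{n,n-2-i}`. -/
theorem iso_r4_reverse {n i : ℕ} (hi : 1 ≤ i) (hin : i + 3 ≤ n) :
    (r4 n i).betweenness.Iso (r4 n (n - 2 - i)).betweenness := by
  have h1 := isNatDist_r4 hi hin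
  have h2 := isNatDist_r4 (n := n) (i := n - 2 - i) (by omega) (by omega)
  let σ : Vertex (n - 2) → Vertex (n - 2)
    | .x j => .x j.rev
    | .y => .y
    | .z => .z
  have hσ : Function.Involutive σ := by
    rintro (j | _ | _) <;> simp [σ]
  have hdist : ∀ u v, lineDist (r4Pos (n - 2) i) 2 u v =
      lineDist (r4Pos (n - 2) (n - 2 - i)) 2 (σ u) (σ v) := by
    intro u v
    rcases u with u | _ | _ <;> rcases v with v | _ | _ <;>
      simp only [σ, lineDist, r4Pos, Fin.val_rev] <;> (try split_ifs) <;> omega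
  refine ⟨hσ.toPerm, fun u v w => ?_⟩
  rw [h1.rel_iff, h2.rel_iff, hdist, hdist, hdist]
  rfl

/-- With `n - 4` triangles, exactly two points are collinear with `y` and `z`. A point separating
`y` from `z` in the orders, in either direction, leads to `S⁴`; if there is none, `y` and `z` have
the same place, which leads to `R⁴`. -/
theorem AlmostMetrizable.iso_of_pair [Fintype X] [DecidableEq X] (hB : B.AlmostMetrizable)
    {n : ℕ} (hX : Fintype.card X = n) (hn : 6 ≤ n) (hco : B.coSize + 4 = n) {y z : X}
    (hyz : y ≠ z) (h : ∀ T, B.IsTriangle T → y ∈ T ∧ z ∈ T) :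
    (∃ i, 1 ≤ i ∧ i + 3 ≤ n ∧ B.Iso (r4 n i).betweenness) ∨
      B.Iso (s4 n (by omega)).betweenness := by
  classical
  obtain ⟨f, g, hfg⟩ := hB.exists_twoOrders (by omega) hyz h
  let N : Finset X := Finset.univ.filter fun w => w ≠ y ∧ w ≠ z ∧ B.Col y z w
  have hN : ∀ w, w ∈ N ↔ w ≠ y ∧ w ≠ z ∧ B.Col y z w := by simp [N]
  have hNcard := hB.coSize_add_card hyz h N hN
  obtain ⟨a, b, hab, hNab⟩ := Finset.card_eq_two.1 (show N.card = 2 by omega)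
  obtain ⟨hay, haz, -⟩ := (hN a).1 (by simp [hNab])
  obtain ⟨hby, hbz, -⟩ := (hN b).1 (by simp [hNab])
  have hNcol : ∀ w, w ≠ y → w ≠ z → (B.Col y z w ↔ w = a ∨ w = b) := by
    intro w hwy hwz
    have := hN w
    rw [hNab] at this
    simp only [Finset.mem_insert, Finset.mem_singleton, hwy, hwz, ne_eq, not_false_iff,
      true_and] at this
    exact this.symm
  have hpos : (B.triangles Finset.univ).Nonempty := by
    rw [← Finset.card_pos, ← coSize_eq_card]
    omega
  obtain ⟨T, hT⟩ := hpos
  have hT' := (mem_triangles.1 hT).2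
  obtain ⟨t, hty, htz, rfl⟩ := hT'.exists_third hyz (h T hT').1 (h T hT').2
  have ht := (hB.isTriangle_triple hyz htz.symm hty.symm).1 hT'
  by_cases h1 : ∃ w, w ≠ y ∧ w ≠ z ∧ f y < f w ∧ g w < g z
  · obtain ⟨w, hwy, hwz, hw1, hw2⟩ := h1
    exact Or.inr (hfg.iso_s4 hB (by omega) hX hty htz ht hab hNcol hay haz hby hbz hwy hwz hw1 hw2)
  by_cases h2 : ∃ w, w ≠ y ∧ w ≠ z ∧ g z < g w ∧ f w < f y
  · obtain ⟨w, hwy, hwz, hw1, hw2⟩ := h2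
    exact Or.inr (hfg.swap.iso_s4 hB (by omega) hX htz hty (fun h' => ht (hB.col_swap_left h')) hab
      (fun w hwz hwy => ⟨fun h' => (hNcol w hwy hwz).1 (hB.col_swap_left h'),
        fun h' => hB.col_swap_left ((hNcol w hwy hwz).2 h')⟩)
      haz hay hbz hby hwz hwy hw1 hw2)
  refine Or.inl (hfg.iso_r4 hB hX hty htz ht hab hNcol hay haz hby hbz fun k hky hkz => ?_)
  push Not at h1 h2
  have h3 := h1 k hky hkz
  have h4 := h2 k hky hkz
  have h5 : f k ≠ f y := fun h' => hky (hfg.inj_left k y hkz hyz h')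
  have h6 : g k ≠ g z := fun h' => hkz (hfg.inj_right k z hky hyz.symm h')
  constructor
  · intro h'
    by_contra h''
    have := h4 (by omega)
    omega
  · intro h'
    by_contra h''
    have := h3 (by omega)
    omega

end BetweennessStructure

/-! ### The value of `τ(n, 0)` and the classification -/

namespace BetweennessStructure

open WeightedGraph Search

variable {X : Type*} {B : BetweennessStructure X}

theorem AlmostMetrizable.le_coSize [Fintype X] (hB : B.AlmostMetrizable) (hpos : 0 < B.coSize) :
    max 1 (Fintype.card X - 4) ≤ B.coSize := by
  classical
  refine max_le hpos ?_
  by_cases h6 : 6 ≤ Fintype.card X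
  · rw [coSize_eq_card] at hpos ⊢
    have := hB.card_le_of_triangle Finset.univ (by rwa [Finset.card_univ]) (Finset.card_pos.1 hpos)
    rw [Finset.card_univ] at this
    omega
  · omega

theorem three_le_card [Fintype X] (hpos : 0 < B.coSize) : 3 ≤ Fintype.card X := by
  rw [coSize_eq_card] at hpos
  obtain ⟨T, hT⟩ := Finset.card_pos.1 hpos
  rw [← (mem_triangles.1 hT).2.1]
  exact Finset.card_le_univ T

theorem AlmostMetrizable.ofOrderCoSize_nonempty [Fintype X] (hB : B.AlmostMetrizable) {n : ℕ}
    (hn : Fintype.card X = n) : (ofOrderCoSize n B.coSize).Nonempty := by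
  let e := Fintype.equivFinOfCardEq hn
  let C : BetweennessStructure (Fin n) := ⟨fun x y z => B.rel (e.symm x) (e.symm y) (e.symm z)⟩
  have h : C.Iso B := ⟨e.symm, fun _ _ _ => Iff.rfl⟩
  exact ⟨C, h.almostMetrizable hB, h.coSize_eq⟩

theorem isTau_zero {n : ℕ} (hn : 3 ≤ n) : IsTau n 0 (max 1 (n - 4)) := by
  refine ⟨⟨lt_of_lt_of_le one_pos (le_max_left _ _), ?_⟩, ?_⟩
  · obtain rfl | rfl | h5 : n = 3 ∨ n = 4 ∨ 5 ≤ n := by omega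
    · have := isNatDist_K3.almostMetrizable.ofOrderCoSize_nonempty (n := 3) (by simp)
      rwa [coSize_K3] at this
    · have := isNatDist_K13.almostMetrizable.ofOrderCoSize_nonempty (n := 4) (by simp)
      rwa [coSize_K13] at this
    · have h := coSize_r4 (n := n) (i := 1) le_rfl (by omega)
      have := (isNatDist_r4 (n := n) (i := 1) le_rfl (by omega)).almostMetrizable
        |>.ofOrderCoSize_nonempty (n := n) (by rw [card_vertex]; omega)
      rwa [show max 1 (n - 4) = (r4 n 1).betweenness.coSize by omega]
  · rintro m ⟨hm, C, hC, rfl⟩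
    simpa using hC.le_coSize hm

theorem Quasilinear.of_iso {V : Type*} [Fintype V] {C : BetweennessStructure V} (h : B.Iso C)
    (hC : C.AlmostMetrizable) (h3 : 3 ≤ Fintype.card V)
    (hco : C.coSize = max 1 (Fintype.card V - 4)) : B.Quasilinear := by
  refine ⟨h.almostMetrizable hC, ?_⟩
  have hcard : Nat.card X = Fintype.card V := by
    obtain ⟨e, -⟩ := h
    rw [Nat.card_congr e, Nat.card_eq_fintype_card]
  rw [hcard, h.coSize_eq, hco]
  exact isTau_zero h3

theorem Quasilinear.coSize_eq [Fintype X] (h : B.Quasilinear) :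
    3 ≤ Fintype.card X ∧ B.coSize = max 1 (Fintype.card X - 4) := by
  obtain ⟨-, h⟩ := h
  rw [Nat.card_eq_fintype_card] at h
  have h3 := three_le_card (B := B) h.1.1
  exact ⟨h3, h.unique (isTau_zero h3)⟩

/-- For an integer `i`, `i ≤ ⌈q⌉` means `i - 1 < q`; here `q = (n - 3) / 2` is a rational quotient.
-/
theorem mem_i4 {n i : ℕ} : i ∈ i4 n ↔ 1 ≤ i ∧ 2 * i + 1 < n := by
  rw [i4, Set.mem_ofPred_eq, Int.le_ceil_iff]
  refine and_congr_right fun _ => ?_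
  rw [lt_div_iff₀ (by norm_num)]
  constructor
  · intro h
    have : (2 * i + 1 : ℚ) < n := by push_cast at h; linarith
    exact_mod_cast this
  · intro h
    have : (2 * i + 1 : ℚ) < n := by exact_mod_cast h
    push_cast
    linarith

/-- The vertices of `R⁴_{5,1}` and `S⁴_5` in the order of the distance tables. -/
def fiveEquiv : Vertex 3 ≃ Fin 5 where
  toFun
    | .x j => j.castLE (by norm_num)
    | .y => 3
    | .z => 4
  invFun := ![.x 0, .x 1, .x 2, .y, .z]
  left_inv := by
    rintro (j | _ | _)
    · fin_cases j <;> rfl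
    · rfl
    · rfl
  right_inv := by decide

theorem distR4_fiveEquiv (u v : Vertex 3) :
    distR4 (fiveEquiv u) (fiveEquiv v) = lineDist (r4Pos 3 1) 2 u v := by
  rcases u with j | _ | _ <;> rcases v with k | _ | _ <;> (try fin_cases j) <;>
    (try fin_cases k) <;> rfl

theorem distS4_fiveEquiv (u v : Vertex 3) :
    distS4 (fiveEquiv u) (fiveEquiv v) = lineDist (s4Pos 3) 2 u v := by
  rcases u with j | _ | _ <;> rcases v with k | _ | _ <;> (try fin_cases j) <;>
    (try fin_cases k) <;> rfl

theorem IsoTable.three (h : B.IsoTable 3 tablesThree) :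
    B.Iso (ofSimple (⊤ : SimpleGraph (Fin 3))).betweenness := by
  obtain ⟨g, hg, h⟩ := h
  rw [tablesThree, List.mem_singleton] at hg
  subst hg
  exact h _ _ (Equiv.refl _) isNatDist_K3.almostMetrizable isNatDist_K3.rel_iff

theorem IsoTable.four (h : B.IsoTable 4 tablesFour) :
    B.Iso (ofSimple (completeBipartiteGraph (Fin 1) (Fin 3))).betweenness ∨
      B.Iso weightedC4.betweenness := by
  obtain ⟨g, hg, h⟩ := h
  simp only [tablesFour, List.mem_cons, List.not_mem_nil, or_false] at hg
  rcases hg with rfl | rfl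
  · exact Or.inl (h _ _ finSumFinEquiv isNatDist_K13.almostMetrizable isNatDist_K13.rel_iff)
  · exact Or.inr (h _ _ (Equiv.refl _) isNatDist_weightedC4.almostMetrizable
      isNatDist_weightedC4.rel_iff)

theorem IsoTable.five (h : B.IsoTable 5 tablesFive) :
    B.Iso (ofSimple (completeBipartiteGraph (Fin 2) (Fin 3))).betweenness ∨
      B.Iso (r4 5 1).betweenness ∨ B.Iso (s4 5 le_rfl).betweenness := by
  obtain ⟨g, hg, h⟩ := h
  simp only [tablesFive, List.mem_cons, List.not_mem_nil, or_false] at hg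
  have hR := isNatDist_r4 (n := 5) (i := 1) le_rfl (by norm_num)
  have hS := isNatDist_s4 (n := 5) le_rfl
  rcases hg with rfl | rfl | rfl
  · exact Or.inl (h _ _ finSumFinEquiv isNatDist_K23.almostMetrizable isNatDist_K23.rel_iff)
  · refine Or.inr (Or.inl (h _ _ fiveEquiv hR.almostMetrizable fun u v w => ?_))
    rw [hR.rel_iff, distR4_fiveEquiv, distR4_fiveEquiv, distR4_fiveEquiv]
  · refine Or.inr (Or.inr (h _ _ fiveEquiv hS.almostMetrizable fun u v w => ?_))
    rw [hS.rel_iff, distS4_fiveEquiv, distS4_fiveEquiv, distS4_fiveEquiv]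

theorem IsoTable.six (h : B.IsoTable 6 tablesSix) :
    B.Iso (ofSimple (SimpleGraph.cycleGraph 6)).betweenness ∨
    B.Iso (ofSimple (SimpleGraph.cycleGraph 6 ⊔ SimpleGraph.edge 0 3)).betweenness ∨
    B.Iso (ofSimple (SimpleGraph.cycleGraph 6 ⊔ SimpleGraph.edge 0 3 ⊔
      SimpleGraph.edge 1 4)).betweenness ∨
    B.Iso (ofSimple (completeBipartiteGraph (Fin 3) (Fin 3))).betweenness := by
  obtain ⟨g, hg, h⟩ := h
  simp only [tablesSix, List.mem_cons, List.not_mem_nil, or_false] at hg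
  rcases hg with rfl | rfl | rfl | rfl
  · exact Or.inl (h _ _ (Equiv.refl _) isNatDist_C6.almostMetrizable isNatDist_C6.rel_iff)
  · exact Or.inr (Or.inl (h _ _ (Equiv.refl _) isNatDist_C6OneDiagonal.almostMetrizable
      isNatDist_C6OneDiagonal.rel_iff))
  · exact Or.inr (Or.inr (Or.inl (h _ _ (Equiv.refl _) isNatDist_C6TwoDiagonals.almostMetrizable
      isNatDist_C6TwoDiagonals.rel_iff)))
  · exact Or.inr (Or.inr (Or.inr (h _ _ cyclicEquiv isNatDist_K33.almostMetrizable
      isNatDist_K33.rel_iff)))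

theorem IsSmallException.quasilinear (h : B.IsSmallException) : B.Quasilinear := by
  rcases h with h | h | h | h | h | h | h | h
  · exact .of_iso h isNatDist_K3.almostMetrizable (by simp) (by simp [coSize_K3])
  · exact .of_iso h isNatDist_K13.almostMetrizable (by simp) (by simp [coSize_K13])
  · exact .of_iso h isNatDist_weightedC4.almostMetrizable (by simp) (by simp [coSize_weightedC4])
  · exact .of_iso h isNatDist_K23.almostMetrizable (by simp) (by simp [coSize_K23])
  · exact .of_iso h isNatDist_C6.almostMetrizable (by simp) (by simp [coSize_C6])
  · exact .of_iso h isNatDist_C6OneDiagonal.almostMetrizable (by simp)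
      (by simp [coSize_C6OneDiagonal])
  · exact .of_iso h isNatDist_C6TwoDiagonals.almostMetrizable (by simp)
      (by simp [coSize_C6TwoDiagonals])
  · exact .of_iso h isNatDist_K33.almostMetrizable (by simp) (by simp [coSize_K33])

theorem Quasilinear.exists_iso_of_pair [Fintype X] [DecidableEq X] (h : B.Quasilinear)
    (hX : 6 ≤ Fintype.card X) {y z : X} (hyz : y ≠ z)
    (hT : ∀ T, B.IsTriangle T → y ∈ T ∧ z ∈ T) :
    (∃ n i : ℕ, 5 ≤ n ∧ i ∈ i4 n ∧ B.Iso (r4 n i).betweenness) ∨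
      (∃ (n : ℕ) (hn : 5 ≤ n), B.Iso (s4 n hn).betweenness) := by
  obtain ⟨-, hco⟩ := h.coSize_eq
  rcases h.1.iso_of_pair rfl hX (by omega) hyz hT with ⟨i, hi, hin, hiso⟩ | hiso
  · left
    -- An index past the middle of the path is brought into `i4` by reversing the path.
    by_cases h' : 2 * i + 1 < Fintype.card X
    · exact ⟨_, i, by omega, mem_i4.2 ⟨hi, h'⟩, hiso⟩
    · exact ⟨_, Fintype.card X - 2 - i, by omega, mem_i4.2 (by omega),
        hiso.trans (iso_r4_reverse hi hin)⟩
  · exact Or.inr ⟨_, _, hiso⟩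

theorem Quasilinear.classification [Finite X] (h : B.Quasilinear) :
    (∃ n i : ℕ, 5 ≤ n ∧ i ∈ i4 n ∧ B.Iso (r4 n i).betweenness) ∨
      (∃ (n : ℕ) (hn : 5 ≤ n), B.Iso (s4 n hn).betweenness) ∨ B.IsSmallException := by
  classical
  have := Fintype.ofFinite X
  obtain ⟨h3, hco⟩ := h.coSize_eq
  have hunique : B.coSize = 1 → ∃ T, B.IsTriangle T ∧ ∀ T', B.IsTriangle T' → T' = T := by
    intro h1
    rw [coSize_eq_card, Finset.card_eq_one] at h1
    obtain ⟨T, hT⟩ := h1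
    have hmem : ∀ T', B.IsTriangle T' ↔ T' = T := fun T' => by
      rw [← Finset.mem_singleton, ← hT, mem_triangles]
      simp
    exact ⟨T, (hmem T).2 rfl, fun T' => (hmem T').1⟩
  obtain hc | hc | hc | hc | hc : Fintype.card X = 3 ∨ Fintype.card X = 4 ∨ Fintype.card X = 5 ∨
    Fintype.card X = 6 ∨ 7 ≤ Fintype.card X := by omega
  · obtain ⟨T, hT, hu⟩ := hunique (by rw [hco, hc]; rfl)
    have := (h.1.isoTable_of_unique hT hu (n := 3) (by norm_num) (by norm_num)
      (by rw [Nat.card_eq_fintype_card, hc]) check_three).three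
    exact Or.inr (Or.inr (Or.inl this))
  · obtain ⟨T, hT, hu⟩ := hunique (by rw [hco, hc]; rfl)
    have := (h.1.isoTable_of_unique hT hu (n := 4) (by norm_num) (by norm_num)
      (by rw [Nat.card_eq_fintype_card, hc]) check_four).four
    unfold IsSmallException
    tauto
  · obtain ⟨T, hT, hu⟩ := hunique (by rw [hco, hc]; rfl)
    rcases (h.1.isoTable_of_unique hT hu (n := 5) (by norm_num) (by norm_num)
      (by rw [Nat.card_eq_fintype_card, hc]) check_five).five with h' | h' | h'
    · unfold IsSmallException
      tauto
    · exact Or.inl ⟨5, 1, le_rfl, mem_i4.2 (by norm_num), h'⟩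
    · exact Or.inr (Or.inl ⟨5, le_rfl, h'⟩)
  · rcases h.1.exists_pair_or_isoTable hc (by rw [hco, hc]; rfl) with ⟨y, z, hyz, hT⟩ | h'
    · rcases h.exists_iso_of_pair hc.ge hyz hT with h' | h'
      · exact Or.inl h'
      · exact Or.inr (Or.inl h')
    · have := h'.six
      unfold IsSmallException
      tauto
  · obtain ⟨y, z, hyz, hT⟩ := h.1.exists_pair_of_seven_le hc (by omega)
    rcases h.exists_iso_of_pair (by omega) hyz hT with h' | h'
    · exact Or.inl h'
    · exact Or.inr (Or.inl h')

end BetweennessStructure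

theorem theorem1 :
    (∀ n : ℕ, 3 ≤ n → BetweennessStructure.IsTau n 0 (max 1 (n - 4))) ∧
    (∀ (X : Type*) [Finite X] [Nonempty X] (B : BetweennessStructure X),
      B.Quasilinear ↔
        (∃ n i : ℕ, 5 ≤ n ∧ i ∈ WeightedGraph.i4 n ∧
          B.Iso (WeightedGraph.r4 n i).betweenness) ∨
        (∃ (n : ℕ) (hn : 5 ≤ n), B.Iso (WeightedGraph.s4 n hn).betweenness) ∨
        B.IsSmallException) := by
  refine ⟨fun n hn => BetweennessStructure.isTau_zero hn, fun X _ _ B => ⟨fun h => h.classification,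
    ?_⟩⟩
  rintro (⟨n, i, hn, hi, h⟩ | ⟨n, hn, h⟩ | h)
  · rw [BetweennessStructure.mem_i4] at hi
    have hco := WeightedGraph.coSize_r4 (n := n) (i := i) hi.1 (by omega)
    have hd := WeightedGraph.isNatDist_r4 (n := n) (i := i) hi.1 (by omega)
    exact .of_iso h hd.almostMetrizable (by rw [WeightedGraph.card_vertex]; omega)
      (by rw [WeightedGraph.card_vertex]; omega)
  · have hco := WeightedGraph.coSize_s4 hn
    have hd := WeightedGraph.isNatDist_s4 hn
    exact .of_iso h hd.almostMetrizable (by rw [WeightedGraph.card_vertex]; omega)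
      (by rw [WeightedGraph.card_vertex]; omega)
  · exact h.quasilinear
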